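/- Let $\rho$ be a two-qubit state, i.e. a positive semidefinite matrix of trace one on $\mathbb C^2\otimes\mathbb C^2$, and let $\rho^\Gamma$ be its partial transpose with respect to the second qubit. Let $N$ be the negativity of $\rho$, twice the sum of the absolute values of the negative eigenvalues of $\rho^\Gamma$ (counted with multiplicity), and let $C=\max(0,\lambda_1-\lambda_2-\lambda_3-\lambda_4)$ be its concurrence, where $\lambda_1\ge\lambda_2\ge\lambda_3\ge\lambda_4$ are the square roots of the eigenvalues of $\sqrt\rho\,(\sigma_y\otimes\sigma_y)\rho^*(\sigma_y\otimes\sigma_y)\sqrt\rho$. The Bell states are $(|00\rangle\pm|11\rangle)/\sqrt2$ and $(|01\rangle\pm|10\rangle)/\sqrt2$; "up to local unitaries" means up to the action of $U\otimes V$ with $U,V$ unitary $2\times2$ matrices. 1. $N\le C$. If $C>0$ (that is, if $\rho$ is entangled), then $\rho^\Gamma$ has exactly one negative eigenvalue $\mu$, its eigenvector is unique up to a scalar, $N=2|\mu|$, and $N=C$ if and only if the normalized eigenvector of $\rho^\Gamma$ for $\mu$ is a Bell state up to local unitaries. Every pure state and every Bell-diagonal state satisfies $N=C$. 2. $N\ge\sqrt{(1-C)^2+C^2}-(1-C)$,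 and $N^2+2N(1-C)-C^2\ge0$. If $C>0$, then equality holds in the first inequality if and only if, up to local unitaries, $\rho$ is the quasi-distillable state $$C\,|\Phi^+\rangle\langle\Phi^+|+(1-C)\,|01\rangle\langle01|,\qquad |\Phi^+\rangle=\tfrac1{\sqrt2}(|00\rangle+|11\rangle),$$ which has rank $2$ when $C<1$ (and is a Bell state when $C=1$). Moreover, if $\rho$ equals $c\,|\Phi^+\rangle\langle\Phi^+|+(1-c)\,|01\rangle\langle01|$ up to local unitaries for some $c\in[0,1]$, then $C=c$. -/

import Mathlib

open scoped Matrix Kronecker ComplexOrder MatrixOrder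

noncomputable section

namespace TwoQubit

/-- Index set of the computational basis: `(i, j)` stands for `|ij⟩`. -/
abbrev Idx : Type := Fin 2 × Fin 2

/-- A (possibly mixed) two-qubit state: a positive semidefinite matrix of trace one. -/
structure State where
  mat : Matrix Idx Idx ℂ
  posSemidef : mat.PosSemidef
  trace_eq_one : mat.trace = 1

/-- Partial transposition with respect to the second qubit. -/
def partialTranspose (A : Matrix Idx Idx ℂ) : Matrix Idx Idx ℂ :=
  Matrix.of fun a b => A (a.1, b.2) (b.1, a.2)

theorem partialTranspose_isHermitian {A : Matrix Idx Idx ℂ} (hA : A.IsHermitian) :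
    (partialTranspose A).IsHermitian := by
  ext a b
  simpa [partialTranspose] using hA.apply (a.1, b.2) (b.1, a.2)

theorem State.isHermitian_partialTranspose (ρ : State) : (partialTranspose ρ.mat).IsHermitian :=
  partialTranspose_isHermitian ρ.posSemidef.isHermitian

/-- Negativity: twice the sum, with multiplicity, of the absolute values of the negative
eigenvalues of the partial transpose. -/
def negativity (ρ : State) : ℝ :=
  2 * ∑ i, max 0 (-(ρ.isHermitian_partialTranspose.eigenvalues i))

/-- The Pauli matrix `σ_y`. -/
def pauliY : Matrix (Fin 2) (Fin 2) ℂ := !![0, -Complex.I; Complex.I, 0]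

/-- The spin-flipped matrix `(σ_y ⊗ σ_y) ρ* (σ_y ⊗ σ_y)`, with the entrywise complex conjugate. -/
def spinFlip (A : Matrix Idx Idx ℂ) : Matrix Idx Idx ℂ :=
  (pauliY ⊗ₖ pauliY) * A.map star * (pauliY ⊗ₖ pauliY)

/-- `√ρ ρ̃ √ρ`, where `ρ̃` is the spin-flipped state. -/
def woottersMatrix (ρ : State) : Matrix Idx Idx ℂ :=
  CFC.sqrt ρ.mat * spinFlip ρ.mat * CFC.sqrt ρ.mat

theorem pauliY_conjTranspose : pauliYᴴ = pauliY := by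
  ext i j
  fin_cases i <;> fin_cases j <;> simp [pauliY]

theorem spinFlip_isHermitian {A : Matrix Idx Idx ℂ} (hA : A.IsHermitian) :
    (spinFlip A).IsHermitian := by
  have h1 : (A.map star)ᴴ = A.map star := by
    ext a b
    simpa using congrArg star (hA.apply a b)
  unfold Matrix.IsHermitian spinFlip
  rw [Matrix.conjTranspose_mul, Matrix.conjTranspose_mul, Matrix.conjTranspose_kronecker,
    pauliY_conjTranspose, h1, Matrix.mul_assoc]

theorem woottersMatrix_isHermitian (ρ : State) : (woottersMatrix ρ).IsHermitian := by
  have h : (CFC.sqrt ρ.mat)ᴴ = CFC.sqrt ρ.mat :=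
    (IsSelfAdjoint.of_nonneg (CFC.sqrt_nonneg ρ.mat)).star_eq
  unfold Matrix.IsHermitian woottersMatrix
  rw [Matrix.conjTranspose_mul, Matrix.conjTranspose_mul, h,
    (spinFlip_isHermitian ρ.posSemidef.isHermitian).eq, Matrix.mul_assoc]

/-- The square roots of the eigenvalues of `√ρ ρ̃ √ρ`, in decreasing order. -/
def woottersValue (ρ : State) (k : Fin 4) : ℝ :=
  √((woottersMatrix_isHermitian ρ).eigenvalues₀ (Fin.cast (by simp) k))

/-- The (Wootters) concurrence `max(0, λ₁ - λ₂ - λ₃ - λ₄)`. -/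
def concurrence (ρ : State) : ℝ :=
  max 0 (woottersValue ρ 0 - woottersValue ρ 1 - woottersValue ρ 2 - woottersValue ρ 3)

/-- The computational basis vector `|ij⟩`. -/
def ket (i j : Fin 2) : Idx → ℂ := Pi.single (i, j) 1

/-- The rank-one matrix `|v⟩⟨v|`. -/
def proj (v : Idx → ℂ) : Matrix Idx Idx ℂ := Matrix.vecMulVec v (star v)

/-- The four Bell states `(|00⟩ ± |11⟩)/√2`, `(|01⟩ ± |10⟩)/√2`. -/
def bell : Fin 4 → Idx → ℂ :=
  ![((√2 : ℝ) : ℂ)⁻¹ • (ket 0 0 + ket 1 1),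
    ((√2 : ℝ) : ℂ)⁻¹ • (ket 0 0 - ket 1 1),
    ((√2 : ℝ) : ℂ)⁻¹ • (ket 0 1 + ket 1 0),
    ((√2 : ℝ) : ℂ)⁻¹ • (ket 0 1 - ket 1 0)]

/-- `v` is a Bell state up to local unitary transformations. -/
def IsBellUpToLocalUnitary (v : Idx → ℂ) : Prop :=
  ∃ U ∈ Matrix.unitaryGroup (Fin 2) ℂ, ∃ V ∈ Matrix.unitaryGroup (Fin 2) ℂ, ∃ k : Fin 4,
    v = (U ⊗ₖ V) *ᵥ bell k

/-- `A` and `B` agree up to a local unitary transformation. -/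
def LocalUnitaryEquiv (A B : Matrix Idx Idx ℂ) : Prop :=
  ∃ U ∈ Matrix.unitaryGroup (Fin 2) ℂ, ∃ V ∈ Matrix.unitaryGroup (Fin 2) ℂ,
    A = (U ⊗ₖ V) * B * (U ⊗ₖ V)ᴴ

/-- The quasi-distillable matrix `c |Φ⁺⟩⟨Φ⁺| + (1 - c) |01⟩⟨01|`, `Φ⁺ = (|00⟩ + |11⟩)/√2`. -/
def quasiDistillable (c : ℝ) : Matrix Idx Idx ℂ :=
  (c : ℂ) • proj (bell 0) + ((1 - c : ℝ) : ℂ) • proj (ket 0 1)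

/-- `ρ` is a pure state. -/
def State.IsPure (ρ : State) : Prop := ∃ ψ : Idx → ℂ, ρ.mat = proj ψ

/-- `ρ` is diagonal in the Bell basis. -/
def State.IsBellDiagonal (ρ : State) : Prop :=
  ∃ p : Fin 4 → ℝ, ρ.mat = ∑ k, (p k : ℂ) • proj (bell k)

end TwoQubit

end

namespace TwoQubit

/-! Write $q(v)=\langle v|\rho^\Gamma|v\rangle$ and let $\det v$ be the determinant of the
$2\times2$ coefficient matrix of $v$. Both quantities are best constants for the same form: $N/2$
bounds $-q(v)/\|v\|^2$, and $C$ is the least $c\ge 0$ with $-q(v)\le c\,|\det v|$ for all $v$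
(`neg_ptForm_le_concurrence`, `concurrence_le_of_forall`). Most of the theorem compares these two
bounds.

That $C$ is a bound follows from Wootters' decomposition: Takagi factorization of the spin-flip
form, suitable phases and a Hadamard rotation write $\rho$ as four rank-one terms of equal
concurrence, at most $C/4$ each, and for a rank-one term the bound is elementary
(`neg_ptForm_proj_le`). That $C$ is least comes from an explicit optimal vector: the Wootters
vectors, divided by the first of them, are simultaneously similar to multiples of the Pauli matrices
(`exists_conj_pauli`), so one vector makes all four terms extremal. Its singular value decomposition
yields a local frame whose X-shaped part has concurrence at least $C$
(`exists_concurrence_le_crossConcurrence`). Singular forms are reached by compactness of the unitary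
groups.

Upper bound: $|\det v|\le\|v\|^2/2$ gives $N\le C$. On product vectors $q\ge0$, and every
two-dimensional space contains a product vector, so there is at most one negative eigenvalue.
Equality needs an eigenvector with $|\det v|=1/2$; conversely, for such an eigenvector the
determinant splits along $v\oplus v^\perp$ and $2|\mu|$ becomes an admissible constant.

Lower bound: in the optimal frame, positivity of $\rho^\Gamma+N/2$ on the span of
$|01\rangle,|10\rangle$, positivity of $\rho$ and the unit trace combine to $C^2\le N^2+2N(1-C)$
(`negativity_lower_bound_aux`). In the equality case every estimate is tight; a null vector of the
block is then an eigenvector of all of $\rho^\Gamma$, which removes the remaining coherences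
(`localUnitaryEquiv_of_frame`). -/

open Matrix Filter Topology

/-! ### Takagi factorization -/

section Takagi

open scoped Matrix.Norms.L2Operator

/-- A symmetric unitary matrix has a symmetric unitary square root, which commutes with everything
that commutes with the given matrix. -/
theorem exists_symm_unitary_sqrt {n : Type*} [Fintype n] [DecidableEq n] {Y : Matrix n n ℂ}
    (hY : Y ∈ unitaryGroup n ℂ) (hs : Yᵀ = Y) :
    ∃ B ∈ unitaryGroup n ℂ, Bᵀ = B ∧ B * B = Y ∧ ∀ D : Matrix n n ℂ, Commute Y D → Commute B D := by
  classical
  have hYn : IsStarNormal Y := ⟨by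
    have h1 := (mem_unitaryGroup_iff).1 hY
    have h2 := (mem_unitaryGroup_iff').1 hY
    rw [Commute, SemiconjBy, h1, h2]⟩
  have hfin := Y.finite_spectrum
  set f : ℂ → ℂ := fun z => Complex.exp (Complex.log z / 2) with hf
  -- Interpolating the square root on the finite spectrum makes the root a polynomial in `Y`:
  -- symmetry and commutation are then immediate, while the functional calculus supplies unitarity
  -- and `B * B = Y`.
  set q : Polynomial ℂ := Lagrange.interpolate hfin.toFinset id f with hq
  have hqf : ∀ z ∈ spectrum ℂ Y, q.eval z = f z := fun z hz =>
    Lagrange.eval_interpolate_at_node (v := id) f Function.injective_id.injOn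
      (hfin.mem_toFinset.2 hz)
  have hunit : ∀ z ∈ spectrum ℂ Y, star z * z = 1 := fun z hz => by
    have := (unitary_iff_isStarNormal_and_spectrum_subset_unitary.1 hY).2 hz
    exact this.1
  have hnorm : ∀ z ∈ spectrum ℂ Y, ‖z‖ = 1 := fun z hz => by
    have h := congrArg (‖·‖) (hunit z hz)
    simp only [norm_mul, norm_star, norm_one] at h
    nlinarith [norm_nonneg z]
  have hcont : ∀ g : ℂ → ℂ, ContinuousOn g (spectrum ℂ Y) := fun g => hfin.continuousOn g
  have hB : Polynomial.aeval Y q = cfc f Y := by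
    rw [← cfc_polynomial q Y]
    exact cfc_congr hqf
  have hff : ∀ z ∈ spectrum ℂ Y, f z * f z = z := fun z hz => by
    have hz0 : z ≠ 0 := fun h => by simpa [h] using hnorm z hz
    rw [hf]
    simp only
    rw [← Complex.exp_add, add_halves, Complex.exp_log hz0]
  refine ⟨Polynomial.aeval Y q, ?_, ?_, ?_, ?_⟩
  · rw [hB]
    refine (cfc_unitary_iff f Y hYn (hcont f)).2 fun z hz => ?_
    have h := congrArg (‖·‖) (hff z hz)
    simp only [norm_mul, hnorm z hz] at h
    have h1 : ‖f z‖ = 1 := by nlinarith [norm_nonneg (f z)]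
    rw [mul_comm]
    simpa [h1] using Complex.mul_conj' (f z)
  · rw [Polynomial.aeval_eq_sum_range, transpose_sum]
    simp only [transpose_smul, transpose_pow, hs]
  · rw [hB, ← cfc_mul f f Y (hcont f) (hcont f), cfc_congr (g := id) (fun z hz => hff z hz),
      cfc_id ℂ Y]
  · intro D hD
    rw [Polynomial.aeval_eq_sum_range]
    exact Commute.sum_left _ _ _ fun i _ => (hD.pow_left i).smul_left _

end Takagi

/-- Takagi factorization of an invertible complex symmetric matrix. -/
theorem exists_takagi {n : Type*} [Fintype n] [DecidableEq n] {τ : Matrix n n ℂ}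
    (hs : τᵀ = τ) (hu : IsUnit τ) :
    ∃ U ∈ unitaryGroup n ℂ, ∃ d : n → ℝ, (∀ i, 0 < d i) ∧
      Uᵀ * τ * U = diagonal fun i => (d i : ℂ) := by
  have hW : (τᴴ * τ).PosDef := PosDef.conjTranspose_mul_self _ (mulVec_injective_of_isUnit hu)
  set V : Matrix n n ℂ := hW.isHermitian.eigenvectorUnitary.1 with hV
  have hVu : V ∈ unitaryGroup n ℂ := hW.isHermitian.eigenvectorUnitary.2
  have hV1 : Vᴴ * V = 1 := mem_unitaryGroup_iff'.1 hVu
  have hV2 : V * Vᴴ = 1 := mem_unitaryGroup_iff.1 hVu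
  set e := hW.isHermitian.eigenvalues with he
  have hepos : ∀ i, 0 < e i := hW.eigenvalues_pos
  set D : Matrix n n ℂ := diagonal fun i => (e i : ℂ) with hD
  have hVD : Vᴴ * (τᴴ * τ) * V = D := by
    have := hW.isHermitian.conjStarAlgAut_star_eigenvectorUnitary
    rw [Unitary.conjStarAlgAut_star_apply] at this
    exact this
  set G : Matrix n n ℂ := Vᵀ * τ * V with hG
  have hGs : Gᵀ = G := by
    simp only [hG, transpose_mul, transpose_transpose, hs, Matrix.mul_assoc]
  have hV3 : Vᵀᴴ * Vᵀ = 1 := by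
    have := congrArg transpose hV2
    rw [transpose_mul, transpose_one] at this
    exact this
  have hGG : Gᴴ * G = D := by
    rw [← hVD]
    simp only [hG, conjTranspose_mul, Matrix.mul_assoc]
    rw [← Matrix.mul_assoc Vᵀᴴ, hV3, Matrix.one_mul]
  -- Transposing `Gᴴ * G = D`: `D` is diagonal and `G` symmetric, so the two factors trade places
  -- and `G` is normal.
  have hGG' : G * Gᴴ = D := by
    have h := congrArg transpose hGG
    rw [transpose_mul, hD, diagonal_transpose, hGs] at h
    have h2 : Gᴴᵀ = G.map star := by ext; simp
    have h3 : Gᴴ = G.map star := by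
      conv_lhs => rw [← hGs]
      ext; simp
    rw [h2, ← h3] at h
    rw [h]
  have hcomm : ∀ i j, G i j * (e j : ℂ) = (e i : ℂ) * G i j := by
    intro i j
    have h : G * D = D * G := by rw [← hGG, ← Matrix.mul_assoc, hGG', hGG]
    have := congrFun (congrFun h i) j
    rwa [hD, mul_diagonal, diagonal_mul] at this
  set d : n → ℝ := fun i => √(e i) with hd
  have hdpos : ∀ i, 0 < d i := fun i => Real.sqrt_pos.2 (hepos i)
  have hdd : ∀ i, (d i : ℂ) * d i = e i := fun i => by
    rw [← Complex.ofReal_mul, Real.mul_self_sqrt (hepos i).le]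
  have hd0 : ∀ i, (d i : ℂ) ≠ 0 := fun i => by exact_mod_cast (hdpos i).ne'
  set Dh : Matrix n n ℂ := diagonal fun i => (d i : ℂ) with hDh
  set Di : Matrix n n ℂ := diagonal fun i => (d i : ℂ)⁻¹ with hDi
  have hDi1 : Di * Dh = 1 := by
    rw [hDi, hDh, diagonal_mul_diagonal, ← diagonal_one]
    congr 1; ext i; exact inv_mul_cancel₀ (hd0 i)
  have hDi2 : Dh * Di = 1 := by
    rw [hDi, hDh, diagonal_mul_diagonal, ← diagonal_one]
    congr 1; ext i; exact mul_inv_cancel₀ (hd0 i)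
  have hDD : Dh * Dh = D := by
    rw [hDh, hD, diagonal_mul_diagonal]
    congr 1; ext i; exact hdd i
  -- A nonzero entry `G i j` forces `e i = e j`, so `G` also commutes with the square root of `D`.
  have hcomm' : G * Dh = Dh * G := by
    ext i j
    rw [hDh, mul_diagonal, diagonal_mul]
    by_cases h0 : G i j = 0
    · simp [h0]
    have h1 := hcomm i j
    rw [mul_comm] at h1
    have h2 : e j = e i := by exact_mod_cast mul_right_cancel₀ h0 h1
    simp only [hd, h2, mul_comm]
  have hcommi : G * Di = Di * G := by
    calc G * Di = Di * (Dh * G) * Di := by rw [← Matrix.mul_assoc Di, hDi1, Matrix.one_mul]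
      _ = Di * G := by rw [← hcomm', Matrix.mul_assoc, Matrix.mul_assoc, hDi2, Matrix.mul_one]
  -- The unitary polar factor of `G`. It is symmetric because `G` commutes with `Di`; splitting it
  -- as `B * B` gives `G = B * Dh * B`, and `Bᴴ` on both sides leaves `Dh`.
  set Y := G * Di with hY
  have hDiH : Diᴴ = Di := by
    rw [hDi, diagonal_conjTranspose]
    congr 1; ext i; simp
  have hDiT : Diᵀ = Di := by rw [hDi, diagonal_transpose]
  have hYu : Y ∈ unitaryGroup n ℂ := by
    rw [mem_unitaryGroup_iff', star_eq_conjTranspose, hY, conjTranspose_mul, hDiH]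
    calc Di * Gᴴ * (G * Di) = Di * (Gᴴ * G) * Di := by simp only [Matrix.mul_assoc]
      _ = (Di * Dh) * (Dh * Di) := by rw [hGG, ← hDD]; simp only [Matrix.mul_assoc]
      _ = 1 := by rw [hDi1, hDi2, Matrix.one_mul]
  have hYs : Yᵀ = Y := by rw [hY, transpose_mul, hGs, hDiT, ← hcommi]
  have hYD : Commute Y Dh := by
    change G * Di * Dh = Dh * (G * Di)
    rw [Matrix.mul_assoc, hDi1, ← hY, hcommi, ← Matrix.mul_assoc, hDi2, Matrix.one_mul,
      Matrix.mul_one]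
  obtain ⟨B, hBu, hBs, hBB, hBc⟩ := exists_symm_unitary_sqrt hYu hYs
  have hB1 : Bᴴ * B = 1 := mem_unitaryGroup_iff'.1 hBu
  have hB2 : B * Bᴴ = 1 := mem_unitaryGroup_iff.1 hBu
  have hGB : G = B * Dh * B := by
    rw [Matrix.mul_assoc, ← (hBc Dh hYD).eq, ← Matrix.mul_assoc, hBB, hY, Matrix.mul_assoc, hDi1,
      Matrix.mul_one]
  refine ⟨V * Bᴴ, mul_mem hVu (Unitary.star_mem hBu), d, hdpos, ?_⟩
  have hBH : Bᴴᵀ = Bᴴ := by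
    conv_rhs => rw [← hBs]
    rfl
  calc (V * Bᴴ)ᵀ * τ * (V * Bᴴ) = Bᴴ * G * Bᴴ := by
        rw [transpose_mul, hBH, hG]; simp only [Matrix.mul_assoc]
    _ = (Bᴴ * B) * Dh * (B * Bᴴ) := by rw [hGB]; simp only [Matrix.mul_assoc]
    _ = Dh := by rw [hB1, hB2, Matrix.one_mul, Matrix.mul_one]

/-! ### The quadratic form of the partial transpose -/

/-- The expectation value `⟨v|A^Γ|v⟩` of the partial transpose of `A`. -/
noncomputable def ptForm (A : Matrix Idx Idx ℂ) (v : Idx → ℂ) : ℝ :=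
  (star v ⬝ᵥ partialTranspose A *ᵥ v).re

/-- The determinant of the coefficient matrix of a two-qubit vector. -/
def vecDet (v : Idx → ℂ) : ℂ := v (0, 0) * v (1, 1) - v (0, 1) * v (1, 0)

/-- The coefficient matrix of a two-qubit vector. -/
def coeffMatrix (v : Idx → ℂ) : Matrix (Fin 2) (Fin 2) ℂ := of fun i j => v (i, j)

/-- The vector with a given coefficient matrix. -/
def ofCoeff (M : Matrix (Fin 2) (Fin 2) ℂ) : Idx → ℂ := fun a => M a.1 a.2

@[simp] theorem coeffMatrix_ofCoeff (M : Matrix (Fin 2) (Fin 2) ℂ) :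
    coeffMatrix (ofCoeff M) = M := rfl

@[simp] theorem ofCoeff_coeffMatrix (v : Idx → ℂ) : ofCoeff (coeffMatrix v) = v := rfl

theorem det_coeffMatrix (v : Idx → ℂ) : (coeffMatrix v).det = vecDet v := by
  simp [det_fin_two, coeffMatrix, vecDet]

theorem coeffMatrix_kronecker_mulVec (U V : Matrix (Fin 2) (Fin 2) ℂ) (v : Idx → ℂ) :
    coeffMatrix ((U ⊗ₖ V) *ᵥ v) = U * coeffMatrix v * Vᵀ := by
  ext i j
  simp [coeffMatrix, mulVec, dotProduct, Fintype.sum_prod_type, Matrix.mul_apply,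
    Fin.sum_univ_two]
  ring

/-- The form depends on the two vectors only through the single matrix $M=A_v^\dagger A_z$, as
$\operatorname{tr}(M\overline M)$, and determinants are multiplicative in $M$. -/
theorem ptForm_proj (z v : Idx → ℂ) :
    ptForm (proj z) v =
      (((coeffMatrix v)ᴴ * coeffMatrix z) *
        ((coeffMatrix v)ᴴ * coeffMatrix z).map star).trace.re := by
  unfold ptForm
  congr 1
  simp [partialTranspose, proj, coeffMatrix, mulVec, dotProduct, Fintype.sum_prod_type,
    Matrix.mul_apply, Fin.sum_univ_two, vecMulVec_apply, trace_fin_two]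
  ring

theorem trace_mul_map_star_re (M : Matrix (Fin 2) (Fin 2) ℂ) :
    (M * M.map star).trace.re =
      ‖M 0 0‖ ^ 2 + ‖M 1 1‖ ^ 2 + 2 * (M 0 1 * star (M 1 0)).re := by
  simp only [trace_fin_two, Matrix.mul_apply, Fin.sum_univ_two, map_apply, Complex.add_re,
    Complex.mul_re, RCLike.star_def, Complex.conj_re, Complex.conj_im, Complex.sq_norm,
    Complex.normSq_apply]
  ring

/-- The elementary inequality behind the entanglement of pure states. -/
theorem neg_trace_mul_conj_le (M : Matrix (Fin 2) (Fin 2) ℂ) :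
    -(M * M.map star).trace.re ≤ 2 * ‖M.det‖ := by
  have h2 : ‖M 0 1 * M 1 0‖ - ‖M 0 0 * M 1 1‖ ≤ ‖M.det‖ := by
    rw [det_fin_two, norm_sub_rev]
    exact norm_sub_norm_le _ _
  have h3 : -(M 0 1 * star (M 1 0)).re ≤ ‖M 0 1 * M 1 0‖ := by
    have := Complex.abs_re_le_norm (M 0 1 * star (M 1 0))
    rw [norm_mul, norm_star, ← norm_mul] at this
    exact (neg_le_abs _).trans this
  rw [norm_mul (M 0 0)] at h2
  rw [trace_mul_map_star_re]
  nlinarith [sq_nonneg (‖M 0 0‖ - ‖M 1 1‖)]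

/-- The rank-one case of the concurrence bound: `neg_trace_mul_conj_le` for the product of the
coefficient matrices. The mixed case is a sum of such estimates. -/
theorem neg_ptForm_proj_le (z v : Idx → ℂ) :
    -ptForm (proj z) v ≤ 2 * ‖vecDet z‖ * ‖vecDet v‖ := by
  rw [ptForm_proj]
  refine (neg_trace_mul_conj_le _).trans_eq ?_
  rw [det_mul, det_conjTranspose, det_coeffMatrix, det_coeffMatrix, norm_mul, norm_star]
  ring

theorem partialTranspose_add (A B : Matrix Idx Idx ℂ) :
    partialTranspose (A + B) = partialTranspose A + partialTranspose B := rfl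

theorem partialTranspose_smul (c : ℂ) (A : Matrix Idx Idx ℂ) :
    partialTranspose (c • A) = c • partialTranspose A := rfl

theorem ptForm_add (A B : Matrix Idx Idx ℂ) (v : Idx → ℂ) :
    ptForm (A + B) v = ptForm A v + ptForm B v := by
  simp [ptForm, partialTranspose_add, add_mulVec, dotProduct_add]

theorem ptForm_smul (c : ℝ) (A : Matrix Idx Idx ℂ) (v : Idx → ℂ) :
    ptForm ((c : ℂ) • A) v = c * ptForm A v := by
  rw [ptForm, partialTranspose_smul, smul_mulVec, dotProduct_smul, smul_eq_mul,
    Complex.re_ofReal_mul, ptForm]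

theorem ptForm_zero (v : Idx → ℂ) : ptForm 0 v = 0 := by
  have : partialTranspose 0 = 0 := rfl
  simp [ptForm, this]

theorem ptForm_sum {ι : Type*} (s : Finset ι) (A : ι → Matrix Idx Idx ℂ) (v : Idx → ℂ) :
    ptForm (∑ i ∈ s, A i) v = ∑ i ∈ s, ptForm (A i) v := by
  classical
  induction s using Finset.induction_on with
  | empty => simp [ptForm_zero]
  | insert i s hi ih => rw [Finset.sum_insert hi, Finset.sum_insert hi, ptForm_add, ih]

theorem mul_conjTranspose_eq_sum_proj {ι : Type*} [Fintype ι] (X : Matrix Idx ι ℂ) :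
    X * Xᴴ = ∑ i, proj (Xᵀ i) := by
  ext a b
  simp [Matrix.mul_apply, Matrix.sum_apply, proj, vecMulVec_apply]

/-! ### Local frames -/

/-- `A` in the local frame given by `U` and `V`. -/
noncomputable def localFrame (U V : Matrix (Fin 2) (Fin 2) ℂ) (A : Matrix Idx Idx ℂ) :
    Matrix Idx Idx ℂ :=
  (U ⊗ₖ V)ᴴ * A * (U ⊗ₖ V)

/-- Transposing the second factor reverses its products, so the unitary acting there is replaced by
its entrywise conjugate. -/
theorem partialTranspose_localFrame (U V : Matrix (Fin 2) (Fin 2) ℂ) (A : Matrix Idx Idx ℂ) :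
    partialTranspose (localFrame U V A) =
      (U ⊗ₖ V.map star)ᴴ * partialTranspose A * (U ⊗ₖ V.map star) := by
  ext a b
  simp [localFrame, partialTranspose, Matrix.mul_apply, Fintype.sum_prod_type, Fin.sum_univ_two]
  ring

theorem ptForm_localFrame (U V : Matrix (Fin 2) (Fin 2) ℂ) (A : Matrix Idx Idx ℂ) (v : Idx → ℂ) :
    ptForm (localFrame U V A) v = ptForm A ((U ⊗ₖ V.map star) *ᵥ v) := by
  rw [ptForm, ptForm, partialTranspose_localFrame, star_mulVec, ← mulVec_mulVec, ← mulVec_mulVec,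
    dotProduct_mulVec]

/-! ### Polarized determinant and simultaneous Pauli form -/

/-- The polarization of the determinant of `2 × 2` matrices. -/
def polarDet (X Y : Matrix (Fin 2) (Fin 2) ℂ) : ℂ :=
  X 0 0 * Y 1 1 + X 1 1 * Y 0 0 - X 0 1 * Y 1 0 - X 1 0 * Y 0 1

theorem polarDet_mul (P X Y : Matrix (Fin 2) (Fin 2) ℂ) :
    polarDet (P * X) (P * Y) = P.det * polarDet X Y := by
  simp [polarDet, Matrix.mul_apply, Fin.sum_univ_two, det_fin_two]
  ring

theorem polarDet_conj (S X Y : Matrix (Fin 2) (Fin 2) ℂ) (hS : IsUnit S.det) :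
    polarDet (S⁻¹ * X * S) (S⁻¹ * Y * S) = polarDet X Y := by
  have h : ∀ X Y, polarDet (X * S) (Y * S) = S.det * polarDet X Y := by
    intro X Y
    simp [polarDet, Matrix.mul_apply, Fin.sum_univ_two, det_fin_two]
    ring
  rw [h, polarDet_mul, ← mul_assoc, det_nonsing_inv, Ring.mul_inverse_cancel _ hS, one_mul]

theorem polarDet_one (X : Matrix (Fin 2) (Fin 2) ℂ) : polarDet 1 X = X.trace := by
  simp [polarDet, trace_fin_two]
  ring

/-- Polarized Cayley–Hamilton for traceless matrices. When the polarized determinant vanishes, the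
two matrices anticommute, which is the Clifford relation used in `exists_conj_pauli`. -/
theorem mul_add_mul_of_trace_eq_zero {K L : Matrix (Fin 2) (Fin 2) ℂ} (hK : K.trace = 0)
    (hL : L.trace = 0) : K * L + L * K = -polarDet K L • (1 : Matrix (Fin 2) (Fin 2) ℂ) := by
  rw [trace_fin_two] at hK hL
  have hK' : K 1 1 = -K 0 0 := by linear_combination hK
  have hL' : L 1 1 = -L 0 0 := by linear_combination hL
  ext i j
  fin_cases i <;> fin_cases j <;>
    simp [polarDet, Matrix.mul_apply, Fin.sum_univ_two, hK', hL'] <;> ring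

theorem mul_self_of_trace_eq_zero {K : Matrix (Fin 2) (Fin 2) ℂ} (hK : K.trace = 0) :
    K * K = -K.det • (1 : Matrix (Fin 2) (Fin 2) ℂ) := by
  rw [trace_fin_two] at hK
  have hK' : K 1 1 = -K 0 0 := by linear_combination hK
  ext i j
  fin_cases i <;> fin_cases j <;>
    simp [Matrix.mul_apply, Fin.sum_univ_two, hK', det_fin_two] <;> ring

/-- Three pairwise orthogonal traceless `2 × 2` matrices with positive determinants are, up to
scalars, simultaneously similar to the Pauli matrices. -/
theorem exists_conj_pauli {K L N : Matrix (Fin 2) (Fin 2) ℂ} (hK : K.trace = 0) (hL : L.trace = 0)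
    (hN : N.trace = 0) (hKL : polarDet K L = 0) (hKN : polarDet K N = 0) (hLN : polarDet L N = 0)
    {s t : ℝ} (hs : 0 < s) (ht : 0 < t) (hKd : K.det = (s : ℂ) ^ 2) (hLd : L.det = (t : ℂ) ^ 2) :
    ∃ S : Matrix (Fin 2) (Fin 2) ℂ, IsUnit S.det ∧
      K = S * !![Complex.I * s, 0; 0, -(Complex.I * s)] * S⁻¹ ∧
      L = S * !![0, -(t : ℂ); (t : ℂ), 0] * S⁻¹ ∧
      ∃ c : ℂ, -c ^ 2 = N.det ∧ N = S * !![0, c; c, 0] * S⁻¹ := by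
  have hs0 : (s : ℂ) ≠ 0 := by exact_mod_cast hs.ne'
  have ht0 : (t : ℂ) ≠ 0 := by exact_mod_cast ht.ne'
  have hI := Complex.I_ne_zero
  have hII := Complex.I_mul_I
  have hdet : (K - (Complex.I * s) • (1 : Matrix (Fin 2) (Fin 2) ℂ)).det = 0 := by
    rw [trace_fin_two] at hK
    rw [det_fin_two] at hKd
    simp only [det_fin_two, Matrix.sub_apply, Matrix.smul_apply, one_apply_eq, smul_eq_mul, ne_eq,
      zero_ne_one, not_false_eq_true, one_apply_ne, one_ne_zero]
    linear_combination hKd - (Complex.I * s) * hK + (s : ℂ) ^ 2 * hII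
  obtain ⟨e, he0, he⟩ := exists_mulVec_eq_zero_iff.2 hdet
  have hKe : K *ᵥ e = (Complex.I * s) • e := by
    rw [sub_mulVec, smul_mulVec, one_mulVec, sub_eq_zero] at he
    exact he
  -- `L` anticommutes with `K` and therefore exchanges its eigenlines for $\pm is$; in the basis `e,
  -- f` it is $t$ times a rotation by a right angle.
  set f : Fin 2 → ℂ := (t : ℂ)⁻¹ • (L *ᵥ e) with hf
  have hLe : L *ᵥ e = (t : ℂ) • f := by rw [hf, smul_smul, mul_inv_cancel₀ ht0, one_smul]
  have hLf : L *ᵥ f = -(t : ℂ) • e := by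
    rw [hf, mulVec_smul, mulVec_mulVec, mul_self_of_trace_eq_zero hL, smul_mulVec, one_mulVec,
      hLd, smul_smul]
    congr 1
    field_simp
  have hKf : K *ᵥ f = -(Complex.I * s) • f := by
    have h : K * L = -(L * K) := by
      have := mul_add_mul_of_trace_eq_zero hK hL
      rw [hKL, neg_zero, zero_smul] at this
      exact eq_neg_of_add_eq_zero_left this
    rw [hf, mulVec_smul, mulVec_mulVec, h, neg_mulVec, ← mulVec_mulVec, hKe, mulVec_smul]
    simp only [smul_neg, smul_smul]
    rw [mul_comm, neg_mul, neg_smul]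
  have hf0 : f ≠ 0 := fun h => by
    rw [h, mulVec_zero, eq_comm, smul_eq_zero] at hLf
    exact hLf.elim (neg_ne_zero.2 ht0) he0
  set S : Matrix (Fin 2) (Fin 2) ℂ := !![e 0, f 0; e 1, f 1] with hS
  have hSd : IsUnit S.det := by
    rw [isUnit_iff_ne_zero]
    intro h
    obtain ⟨w, hw0, hw⟩ := exists_mulVec_eq_zero_iff.2 h
    have h1 : w 0 • e + w 1 • f = 0 := by
      ext i
      have := congrFun hw i
      fin_cases i <;> simp [hS, mulVec, dotProduct, Fin.sum_univ_two] at this ⊢ <;>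
        linear_combination this
    have h2 : w 0 • e - w 1 • f = 0 := by
      have h3 := congrArg (K *ᵥ ·) h1
      simp only [mulVec_add, mulVec_smul, hKe, hKf, mulVec_zero] at h3
      have h4 : (Complex.I * s) • (w 0 • e - w 1 • f) = 0 := by
        rw [← h3, smul_sub, smul_comm, smul_comm _ (w 1), neg_smul, smul_neg, sub_eq_add_neg]
      exact (smul_eq_zero.1 h4).resolve_left (mul_ne_zero hI hs0)
    have h5 : w 0 • e = 0 := by
      have : (2 : ℂ) • (w 0 • e) = 0 := by rw [two_smul]; linear_combination h1 + h2
      exact (smul_eq_zero.1 this).resolve_left two_ne_zero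
    have h6 : w 1 • f = 0 := by rwa [h5, zero_add] at h1
    apply hw0
    ext i
    fin_cases i
    · exact (smul_eq_zero.1 h5).resolve_right he0
    · exact (smul_eq_zero.1 h6).resolve_right hf0
  have hconj : ∀ A C : Matrix (Fin 2) (Fin 2) ℂ, A * S = S * C → A = S * C * S⁻¹ := by
    intro A C h
    rw [← h, Matrix.mul_assoc, mul_nonsing_inv _ hSd, Matrix.mul_one]
  have hK' : K = S * !![Complex.I * s, 0; 0, -(Complex.I * s)] * S⁻¹ := by
    apply hconj
    ext i j
    have h1 := congrFun hKe i
    have h2 := congrFun hKf i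
    fin_cases i <;> fin_cases j <;>
      simp [hS, mulVec, dotProduct, Fin.sum_univ_two, Matrix.mul_apply] at h1 h2 ⊢ <;>
      first
      | linear_combination h1
      | linear_combination h2
  have hL' : L = S * !![0, -(t : ℂ); (t : ℂ), 0] * S⁻¹ := by
    apply hconj
    ext i j
    have h1 := congrFun hLe i
    have h2 := congrFun hLf i
    fin_cases i <;> fin_cases j <;>
      simp [hS, mulVec, dotProduct, Fin.sum_univ_two, Matrix.mul_apply] at h1 h2 ⊢ <;>
      first
      | linear_combination h1
      | linear_combination h2
  refine ⟨S, hSd, hK', hL', ?_⟩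
  -- In the basis `e, f`, tracelessness and orthogonality to `K` remove the diagonal of `N`, and
  -- orthogonality to `L` makes its off-diagonal entries equal.
  set P := S⁻¹ * N * S with hP
  have hNP : N = S * P * S⁻¹ := by
    rw [hP]
    simp only [← Matrix.mul_assoc]
    rw [mul_nonsing_inv _ hSd, Matrix.one_mul, Matrix.mul_assoc, mul_nonsing_inv _ hSd,
      Matrix.mul_one]
  have hcan : ∀ C : Matrix (Fin 2) (Fin 2) ℂ, S⁻¹ * (S * C * S⁻¹) * S = C := by
    intro C
    simp only [← Matrix.mul_assoc]
    rw [nonsing_inv_mul _ hSd, Matrix.one_mul, Matrix.mul_assoc, nonsing_inv_mul _ hSd,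
      Matrix.mul_one]
  have e1 : P.trace = 0 := by
    rw [hP, trace_mul_comm, ← Matrix.mul_assoc, mul_nonsing_inv _ hSd, Matrix.one_mul, hN]
  have e2 := polarDet_conj S K N hSd
  have e3 := polarDet_conj S L N hSd
  have e4 : P.det = N.det := by
    rw [hP, det_mul, det_mul, mul_right_comm, ← det_mul, nonsing_inv_mul _ hSd, det_one, one_mul]
  rw [hKN, hK', hcan, ← hP] at e2
  rw [hLN, hL', hcan, ← hP] at e3
  rw [trace_fin_two] at e1
  simp [polarDet] at e2 e3
  have p11 : P 1 1 = -P 0 0 := by linear_combination e1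
  have p00 : P 0 0 = 0 := by
    rw [p11] at e2
    have : (Complex.I * s) * P 0 0 = 0 := by linear_combination (-1 / 2) * e2
    exact (mul_eq_zero.1 this).resolve_left (mul_ne_zero hI hs0)
  have p10 : P 1 0 = P 0 1 := by
    have : (t : ℂ) * (P 1 0 - P 0 1) = 0 := by linear_combination e3
    exact sub_eq_zero.1 ((mul_eq_zero.1 this).resolve_left ht0)
  refine ⟨P 0 1, ?_, ?_⟩
  · rw [← e4, det_fin_two, p11, p00, p10]; ring
  · conv_lhs => rw [hNP]
    congr 2
    ext i j
    fin_cases i <;> fin_cases j <;> simp [p00, p11, p10]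

/-- $M\mapsto \overline S M S^{-1}$ is a change of basis for the antilinear map attached to $M$:
$S^{-1}S$ cancels inside the product and $\overline{S^{-1}}\,\overline S$ cancels by cyclicity of
the trace. -/
theorem trace_conj_mul_map_star (S N : Matrix (Fin 2) (Fin 2) ℂ) (hS : IsUnit S.det) :
    ((S.map star * N * S⁻¹) * (S.map star * N * S⁻¹).map star).trace = (N * N.map star).trace := by
  have hmap : ∀ A B : Matrix (Fin 2) (Fin 2) ℂ, (A * B).map star = A.map star * B.map star := by
    intro A B
    exact Matrix.map_mul (f := starRingEnd ℂ)
  have hss : (S.map star).map star = S := by ext; simp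
  have hinv : (S⁻¹).map star * S.map star = 1 := by
    rw [← hmap, nonsing_inv_mul _ hS]
    ext i j
    by_cases h : i = j <;> simp [one_apply, h]
  rw [hmap, hmap, hss]
  calc (S.map star * N * S⁻¹ * (S * N.map star * (S⁻¹).map star)).trace
      = (S.map star * (N * (S⁻¹ * S) * N.map star * (S⁻¹).map star)).trace := by
        simp only [Matrix.mul_assoc]
    _ = (N * N.map star * ((S⁻¹).map star * S.map star)).trace := by
        rw [trace_mul_comm, nonsing_inv_mul _ hS, Matrix.mul_one, Matrix.mul_assoc]
    _ = _ := by rw [hinv, Matrix.mul_one]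

/-- The optimal test vector. Dividing by `X 0` gives the identity and three traceless, pairwise
anticommuting matrices, simultaneously similar to multiples of Pauli matrices. Multiplying on the
left by the antisymmetric `J`, transported by $\overline S\cdot S^{-1}$, makes the first trace
negative and the other three positive, with moduli proportional to the `lam i`. -/
theorem exists_det_ne_zero_neg_sum_trace_eq (X : Fin 4 → Matrix (Fin 2) (Fin 2) ℂ)
    (lam : Fin 4 → ℝ) (hpos : ∀ i, 0 < lam i) (hdet : ∀ i, 2 * (X i).det = -(lam i : ℂ))
    (horth : ∀ i j, i ≠ j → polarDet (X i) (X j) = 0) :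
    ∃ A : Matrix (Fin 2) (Fin 2) ℂ, A.det ≠ 0 ∧
      -∑ i, ((Aᴴ * X i) * (Aᴴ * X i).map star).trace.re =
        ‖A.det‖ * (lam 0 - lam 1 - lam 2 - lam 3) := by
  have hl0 : ∀ i, (lam i : ℂ) ≠ 0 := fun i => by exact_mod_cast (hpos i).ne'
  have hdet' : ∀ i, (X i).det = -(lam i : ℂ) / 2 := fun i => by
    linear_combination (1 / 2) * hdet i
  have hu : IsUnit (X 0).det := by
    rw [isUnit_iff_ne_zero, hdet']
    exact div_ne_zero (neg_ne_zero.2 (hl0 0)) two_ne_zero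
  have hu0 := hu.ne_zero
  set K : Fin 4 → Matrix (Fin 2) (Fin 2) ℂ := fun i => (X 0)⁻¹ * X i with hK
  have hXK : ∀ i, X i = X 0 * K i := fun i => by
    rw [hK, ← Matrix.mul_assoc, mul_nonsing_inv _ hu, Matrix.one_mul]
  have hpol : ∀ i j, i ≠ j → polarDet (K i) (K j) = 0 := fun i j hij => by
    have := horth i j hij
    rw [hXK i, hXK j, polarDet_mul] at this
    exact (mul_eq_zero.1 this).resolve_left hu0
  have hK0 : K 0 = 1 := nonsing_inv_mul _ hu
  have htr : ∀ j, j ≠ 0 → (K j).trace = 0 := fun j hj => by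
    rw [← polarDet_one, ← hK0]
    exact hpol 0 j hj.symm
  set s : Fin 4 → ℝ := fun i => √(lam i / lam 0) with hs
  have hspos : ∀ i, 0 < s i := fun i => Real.sqrt_pos.2 (div_pos (hpos i) (hpos 0))
  have hs2 : ∀ i, s i ^ 2 = lam i / lam 0 := fun i =>
    Real.sq_sqrt (div_pos (hpos i) (hpos 0)).le
  have hKd : ∀ i, (K i).det = (s i : ℂ) ^ 2 := fun i => by
    have h1 : (X 0).det * (K i).det = (X i).det := by rw [← det_mul, ← hXK]
    have h2 : (s i : ℂ) ^ 2 = lam i / lam 0 := by exact_mod_cast hs2 i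
    rw [h2]
    rw [hdet', hdet'] at h1
    rw [eq_div_iff (hl0 0)]
    linear_combination (-2) * h1
  obtain ⟨S, hSu, h1, h2, c, hc, h3⟩ := exists_conj_pauli (htr 1 (by decide)) (htr 2 (by decide))
    (htr 3 (by decide)) (hpol 1 2 (by decide)) (hpol 1 3 (by decide)) (hpol 2 3 (by decide))
    (hspos 1) (hspos 2) (hKd 1) (hKd 2)
  have hcn : ‖c‖ ^ 2 = s 3 ^ 2 := by
    have := congrArg (‖·‖) (hc.trans (hKd 3))
    simpa using this
  set J : Matrix (Fin 2) (Fin 2) ℂ := !![0, -1; 1, 0] with hJ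
  -- With $\overline S$ on the left instead of $S$, the traces are independent of $S$ by
  -- `trace_conj_mul_map_star`; moreover $|\det Q|=1$, so only `X 0` contributes to the modulus of
  -- the determinant.
  set Q := S.map star * J * S⁻¹ with hQ
  have hQX : ∀ i, (((Q * (X 0)⁻¹)ᴴ)ᴴ * X i) = Q * K i := fun i => by
    rw [conjTranspose_conjTranspose, hK, Matrix.mul_assoc]
  have hdetA : ‖((Q * (X 0)⁻¹)ᴴ).det‖ = 2 / lam 0 := by
    have hm : (S.map star).det = star S.det := by
      have : S.map star = Sᴴᵀ := by ext; simp
      rw [this, det_transpose, det_conjTranspose]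
    have hJd : J.det = 1 := by simp [hJ, det_fin_two]
    rw [det_conjTranspose, norm_star, hQ, det_mul, det_mul, det_mul, hm, hJd, mul_one,
      norm_mul, norm_mul, norm_star, det_nonsing_inv, det_nonsing_inv, Ring.inverse_eq_inv',
      norm_inv, norm_inv, mul_inv_cancel₀ (norm_ne_zero_iff.2 hSu.ne_zero), one_mul, hdet']
    rw [norm_div, norm_neg, Complex.norm_real, Real.norm_of_nonneg (hpos 0).le]
    simp
  refine ⟨(Q * (X 0)⁻¹)ᴴ, ?_, ?_⟩
  · rw [← norm_ne_zero_iff, hdetA]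
    exact (div_pos two_pos (hpos 0)).ne'
  have hconj : ∀ C : Matrix (Fin 2) (Fin 2) ℂ, Q * (S * C * S⁻¹) = S.map star * (J * C) * S⁻¹ := by
    intro C
    rw [hQ]
    calc S.map star * J * S⁻¹ * (S * C * S⁻¹)
        = S.map star * (J * ((S⁻¹ * S) * C)) * S⁻¹ := by simp only [Matrix.mul_assoc]
      _ = _ := by rw [nonsing_inv_mul _ hSu, Matrix.one_mul]
  have t0 : ((Q * K 0) * (Q * K 0).map star).trace.re = -2 := by
    rw [hK0, Matrix.mul_one, hQ, trace_conj_mul_map_star _ _ hSu, trace_mul_map_star_re]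
    simp [hJ]
  have t1 : ((Q * K 1) * (Q * K 1).map star).trace.re = 2 * s 1 ^ 2 := by
    rw [h1, hconj, trace_conj_mul_map_star _ _ hSu, trace_mul_map_star_re]
    simp [hJ]
    ring
  have t2 : ((Q * K 2) * (Q * K 2).map star).trace.re = 2 * s 2 ^ 2 := by
    rw [h2, hconj, trace_conj_mul_map_star _ _ hSu, trace_mul_map_star_re]
    simp [hJ]
    ring
  have t3 : ((Q * K 3) * (Q * K 3).map star).trace.re = 2 * s 3 ^ 2 := by
    rw [h3, hconj, trace_conj_mul_map_star _ _ hSu, ← hcn, trace_mul_map_star_re]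
    simp [hJ]
    ring
  rw [Fin.sum_univ_four]
  simp only [hQX]
  rw [t0, t1, t2, t3, hdetA, hs2, hs2, hs2]
  have := (hpos 0).ne'
  field_simp
  ring

/-! ### Singular values and the X-shaped part -/

theorem norm_det_of_mem_unitaryGroup {n : Type*} [Fintype n] [DecidableEq n] {R : Matrix n n ℂ}
    (hR : R ∈ unitaryGroup n ℂ) : ‖R.det‖ = 1 :=
  CStarRing.norm_of_mem_unitary (det_of_mem_unitary hR)

/-- Singular value decomposition of an invertible matrix. -/
theorem exists_svd {n : Type*} [Fintype n] [DecidableEq n] {A : Matrix n n ℂ} (hA : IsUnit A) :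
    ∃ R ∈ unitaryGroup n ℂ, ∃ S ∈ unitaryGroup n ℂ, ∃ d : n → ℝ, (∀ i, 0 < d i) ∧
      A = R * (diagonal fun i => (d i : ℂ)) * S := by
  have hW : (Aᴴ * A).PosDef := PosDef.conjTranspose_mul_self _ (mulVec_injective_of_isUnit hA)
  set V : Matrix n n ℂ := hW.isHermitian.eigenvectorUnitary.1 with hV
  have hVu : V ∈ unitaryGroup n ℂ := hW.isHermitian.eigenvectorUnitary.2
  have hV2 : V * Vᴴ = 1 := mem_unitaryGroup_iff.1 hVu
  set e := hW.isHermitian.eigenvalues with he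
  have hepos : ∀ i, 0 < e i := hW.eigenvalues_pos
  have hVD : Vᴴ * (Aᴴ * A) * V = diagonal fun i => (e i : ℂ) := by
    have := hW.isHermitian.conjStarAlgAut_star_eigenvectorUnitary
    rw [Unitary.conjStarAlgAut_star_apply] at this
    exact this
  set d : n → ℝ := fun i => √(e i) with hd
  have hdpos : ∀ i, 0 < d i := fun i => Real.sqrt_pos.2 (hepos i)
  have hdd : ∀ i, (d i : ℂ) * d i = e i := fun i => by
    rw [← Complex.ofReal_mul, Real.mul_self_sqrt (hepos i).le]
  have hd0 : ∀ i, (d i : ℂ) ≠ 0 := fun i => by exact_mod_cast (hdpos i).ne'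
  set Di : Matrix n n ℂ := diagonal fun i => (d i : ℂ)⁻¹ with hDi
  have hDiH : Diᴴ = Di := by
    rw [hDi, diagonal_conjTranspose]
    congr 1; ext i; simp
  refine ⟨A * V * Di, ?_, Vᴴ, Unitary.star_mem hVu, d, hdpos, ?_⟩
  · rw [mem_unitaryGroup_iff', star_eq_conjTranspose, conjTranspose_mul, conjTranspose_mul, hDiH]
    calc Di * (Vᴴ * Aᴴ) * (A * V * Di) = Di * (Vᴴ * (Aᴴ * A) * V) * Di := by
          simp only [Matrix.mul_assoc]
      _ = 1 := by
          rw [hVD, hDi, diagonal_mul_diagonal, diagonal_mul_diagonal, ← diagonal_one]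
          congr 1; ext i
          rw [← hdd]
          have := hd0 i
          field_simp
  · have : Di * (diagonal fun i => (d i : ℂ)) = 1 := by
      rw [hDi, diagonal_mul_diagonal, ← diagonal_one]
      congr 1; ext i; exact inv_mul_cancel₀ (hd0 i)
    rw [Matrix.mul_assoc (A * V), this, Matrix.mul_one, Matrix.mul_assoc, hV2, Matrix.mul_one]

/-- The concurrence of the X-shaped part of a matrix. -/
noncomputable def crossConcurrence (B : Matrix Idx Idx ℂ) : ℝ :=
  2 * ‖B (0, 0) (1, 1)‖ - 2 * √((B (0, 1) (0, 1)).re * (B (1, 0) (1, 0)).re)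

/-- Partial transposition moves the coherence between $|00\rangle$ and $|11\rangle$ into the block
of $|01\rangle,|10\rangle$, so vectors supported there see only the X-shaped part. -/
theorem ptForm_antidiagonal (B : Matrix Idx Idx ℂ) (v : Idx → ℂ) (h0 : v (0, 0) = 0)
    (h1 : v (1, 1) = 0) :
    ptForm B v = (star (v (0, 1)) * v (0, 1) * B (0, 1) (0, 1)
      + star (v (1, 0)) * v (1, 0) * B (1, 0) (1, 0)
      + star (v (0, 1)) * v (1, 0) * B (0, 0) (1, 1)
      + star (v (1, 0)) * v (0, 1) * B (1, 1) (0, 0)).re := by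
  unfold ptForm
  congr 1
  simp [mulVec, dotProduct, Fintype.sum_prod_type, Fin.sum_univ_two, partialTranspose, h0, h1]
  ring

/-- Arithmetic–geometric mean for the two diagonal terms: $k^2a+l^2b\ge 2kl\sqrt{ab}$. -/
theorem neg_ptForm_antidiagonal_le {B : Matrix Idx Idx ℂ} (hB : B.PosSemidef) {k l : ℝ}
    (hk : 0 ≤ k) (hl : 0 ≤ l) (v : Idx → ℂ) (h0 : v (0, 0) = 0) (h1 : v (1, 1) = 0)
    (h2 : v (0, 1) = k) (h3 : v (1, 0) = l) :
    -ptForm B v ≤ k * l * crossConcurrence B := by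
  have hH : B (1, 1) (0, 0) = star (B (0, 0) (1, 1)) := (hB.isHermitian.apply _ _).symm
  have ha : 0 ≤ (B (0, 1) (0, 1)).re := (Complex.le_def.1 (hB.diag_nonneg (i := (0, 1)))).1
  have hb : 0 ≤ (B (1, 0) (1, 0)).re := (Complex.le_def.1 (hB.diag_nonneg (i := (1, 0)))).1
  have hr := (neg_le_abs _).trans (Complex.abs_re_le_norm (B (0, 0) (1, 1)))
  have hf : ptForm B v = k ^ 2 * (B (0, 1) (0, 1)).re + l ^ 2 * (B (1, 0) (1, 0)).re
      + 2 * (k * l) * (B (0, 0) (1, 1)).re := by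
    rw [ptForm_antidiagonal B v h0 h1, h2, h3, hH]
    simp
    ring
  rw [hf, crossConcurrence, Real.sqrt_mul ha]
  have e1 := Real.sq_sqrt ha
  have e2 := Real.sq_sqrt hb
  set a := √(B (0, 1) (0, 1)).re
  set b := √(B (1, 0) (1, 0)).re
  rw [← e1, ← e2]
  nlinarith [sq_nonneg (k * a - l * b), mul_le_mul_of_nonneg_left hr (mul_nonneg hk hl)]

theorem posSemidef_localFrame {A : Matrix Idx Idx ℂ} (hA : A.PosSemidef)
    (U V : Matrix (Fin 2) (Fin 2) ℂ) : (localFrame U V A).PosSemidef :=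
  hA.conjTranspose_mul_mul_same _

/-- The bilinear form of `σ_y ⊗ σ_y` is minus the polarized determinant. -/
theorem transpose_mul_spinFlip_mul_apply {ι : Type*} (X : Matrix Idx ι ℂ) (i j : ι) :
    (Xᵀ * (pauliY ⊗ₖ pauliY) * X) i j = -polarDet (coeffMatrix (Xᵀ i)) (coeffMatrix (Xᵀ j)) := by
  simp [Matrix.mul_apply, Fintype.sum_prod_type, Fin.sum_univ_two, pauliY, polarDet, coeffMatrix]
  ring

theorem polarDet_self (X : Matrix (Fin 2) (Fin 2) ℂ) : polarDet X X = 2 * X.det := by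
  simp [polarDet, det_fin_two]
  ring

/-- Takagi factorization with decreasingly ordered values. -/
theorem exists_takagi_antitone {m : ℕ} {τ : Matrix (Fin m) (Fin m) ℂ} (hs : τᵀ = τ)
    (hu : IsUnit τ) :
    ∃ U ∈ unitaryGroup (Fin m) ℂ, ∃ d : Fin m → ℝ, Antitone d ∧ (∀ i, 0 < d i) ∧
      Uᵀ * τ * U = diagonal fun i => (d i : ℂ) := by
  obtain ⟨U, hU, d, hd, h⟩ := exists_takagi hs hu
  set σ := Tuple.sort fun i => -d i
  have hσ : Monotone ((fun i => -d i) ∘ σ) := Tuple.monotone_sort _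
  refine ⟨U.submatrix id σ, ?_, d ∘ σ, fun i j hij => by simpa using hσ hij, fun i => hd _, ?_⟩
  · rw [mem_unitaryGroup_iff'] at hU ⊢
    have : star (U.submatrix id σ) * U.submatrix id σ = (star U * U).submatrix σ σ := rfl
    rw [this, hU, submatrix_one_equiv]
  · have : (U.submatrix id σ)ᵀ * τ * U.submatrix id σ = (Uᵀ * τ * U).submatrix σ σ := rfl
    rw [this, h, submatrix_diagonal_equiv]
    rfl

/-! ### Optimal local frame: invertible forms and limits -/

/-- Invertible case of the simultaneous Takagi factorization and optimal local frame. -/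
theorem exists_localFrame_of_isUnit {T : Matrix Idx (Fin 4) ℂ}
    (hT : IsUnit (Tᵀ * (pauliY ⊗ₖ pauliY) * T)) :
    ∃ W ∈ unitaryGroup (Fin 4) ℂ, ∃ U ∈ unitaryGroup (Fin 2) ℂ, ∃ V ∈ unitaryGroup (Fin 2) ℂ,
      ∃ lam : Fin 4 → ℝ, Antitone lam ∧ (∀ i, 0 ≤ lam i) ∧
        (T * W)ᵀ * (pauliY ⊗ₖ pauliY) * (T * W) = (diagonal fun i => (lam i : ℂ)) ∧
        lam 0 - lam 1 - lam 2 - lam 3 ≤ crossConcurrence (localFrame U V (T * Tᴴ)) := by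
  have hsymm : (Tᵀ * (pauliY ⊗ₖ pauliY) * T)ᵀ = Tᵀ * (pauliY ⊗ₖ pauliY) * T := by
    ext i j
    rw [transpose_apply, transpose_mul_spinFlip_mul_apply, transpose_mul_spinFlip_mul_apply]
    simp only [polarDet]
    ring
  obtain ⟨W, hW, lam, hanti, hpos, h⟩ := exists_takagi_antitone hsymm hT
  have hTW : (T * W)ᵀ * (pauliY ⊗ₖ pauliY) * (T * W) = diagonal fun i => (lam i : ℂ) := by
    rw [← h, transpose_mul]
    simp only [Matrix.mul_assoc]
  set X : Fin 4 → Matrix (Fin 2) (Fin 2) ℂ := fun i => coeffMatrix ((T * W)ᵀ i) with hX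
  have hent : ∀ i j, -polarDet (X i) (X j) = (diagonal fun i => (lam i : ℂ)) i j := fun i j => by
    rw [← hTW, transpose_mul_spinFlip_mul_apply]
  obtain ⟨A, hA0, hA⟩ := exists_det_ne_zero_neg_sum_trace_eq X lam hpos
    (fun i => by
      have := hent i i
      rw [diagonal_apply_eq, polarDet_self] at this
      rw [← this, neg_neg])
    (fun i j hij => by
      have := hent i j
      rwa [diagonal_apply_ne _ hij, neg_eq_zero] at this)
  have hTT : T * Tᴴ = ∑ i, proj ((T * W)ᵀ i) := by
    rw [← mul_conjTranspose_eq_sum_proj, conjTranspose_mul, Matrix.mul_assoc,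
      ← Matrix.mul_assoc W]
    rw [show W * Wᴴ = 1 from mem_unitaryGroup_iff.1 hW, Matrix.one_mul]
  have hform : -ptForm (T * Tᴴ) (ofCoeff A) = ‖A.det‖ * (lam 0 - lam 1 - lam 2 - lam 3) := by
    rw [← hA, hTT, ptForm_sum]
    simp only [ptForm_proj, coeffMatrix_ofCoeff, hX]
  have hsw : (!![0, 1; 1, 0] : Matrix (Fin 2) (Fin 2) ℂ) * !![0, 1; 1, 0] = 1 := by
    ext i j; fin_cases i <;> fin_cases j <;> simp
  have hswH : (!![0, 1; 1, 0] : Matrix (Fin 2) (Fin 2) ℂ)ᴴ = !![0, 1; 1, 0] := by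
    ext i j; fin_cases i <;> fin_cases j <;> simp
  -- The singular value decomposition turns the optimal vector into local unitaries applied to a
  -- diagonal vector with weights `d`. The bit flip moves it to $|01\rangle,|10\rangle$, where the
  -- form is controlled by `crossConcurrence`; the factor $d_0d_1=|\det A|$ then cancels.
  obtain ⟨R, hR, S, hS, d, hd, hAd⟩ :=
    exists_svd ((isUnit_iff_isUnit_det A).2 (isUnit_iff_ne_zero.2 hA0))
  have hnorm : ‖A.det‖ = d 0 * d 1 := by
    rw [hAd, det_mul, det_mul, det_diagonal, norm_mul, norm_mul, norm_det_of_mem_unitaryGroup hR,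
      norm_det_of_mem_unitaryGroup hS, Fin.prod_univ_two, norm_mul,
      Complex.norm_real, Complex.norm_real, Real.norm_of_nonneg (hd 0).le,
      Real.norm_of_nonneg (hd 1).le]
    ring
  refine ⟨W, hW, R, hR, Sᴴ * !![0, 1; 1, 0], mul_mem (Unitary.star_mem hS) ?_, lam, hanti,
    fun i => (hpos i).le, hTW, ?_⟩
  · rw [mem_unitaryGroup_iff, star_eq_conjTranspose, hswH, hsw]
  set v : Idx → ℂ := ofCoeff !![0, (d 0 : ℂ); (d 1 : ℂ), 0] with hv
  have hAv : ofCoeff A = (R ⊗ₖ (Sᴴ * !![0, 1; 1, 0]).map star) *ᵥ v := by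
    rw [← ofCoeff_coeffMatrix ((R ⊗ₖ _) *ᵥ v), coeffMatrix_kronecker_mulVec]
    congr 1
    have h1 : ((Sᴴ * !![0, 1; 1, 0]).map star)ᵀ = !![0, 1; 1, 0] * S := by
      change (Sᴴ * !![0, 1; 1, 0])ᴴ = _
      rw [conjTranspose_mul, conjTranspose_conjTranspose, hswH]
    rw [h1, hv, coeffMatrix_ofCoeff, hAd, ← Matrix.mul_assoc, Matrix.mul_assoc R (!![0, _; _, 0])]
    congr 2
    ext i j; fin_cases i <;> fin_cases j <;> simp
  have hle := neg_ptForm_antidiagonal_le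
    (posSemidef_localFrame (posSemidef_self_mul_conjTranspose T) R (Sᴴ * !![0, 1; 1, 0]))
    (hd 0).le (hd 1).le v rfl rfl rfl rfl
  rw [ptForm_localFrame, ← hAv, hform, hnorm] at hle
  exact le_of_mul_le_mul_left hle (mul_pos (hd 0) (hd 1))

theorem isCompact_unitaryGroup (n : Type*) [Fintype n] [DecidableEq n] :
    IsCompact {U : Matrix n n ℂ | U ∈ unitaryGroup n ℂ} := by
  have hK : IsCompact
      (Set.univ.pi fun _ : n => Set.univ.pi fun _ : n => Metric.closedBall (0 : ℂ) 1) :=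
    isCompact_univ_pi fun _ => isCompact_univ_pi fun _ => isCompact_closedBall _ _
  refine IsCompact.of_isClosed_subset (X := Matrix n n ℂ) hK ?_ ?_
  · have : {U : Matrix n n ℂ | U ∈ unitaryGroup n ℂ} = {U | U * Uᴴ = 1} := by
      ext U; exact mem_unitaryGroup_iff
    rw [this]
    exact isClosed_eq (by fun_prop) continuous_const
  · intro U hU i _ j _
    rw [mem_closedBall_zero_iff]
    exact entry_norm_bound_of_unitary hU i j

theorem continuous_kronecker {m n : Type*} :
    Continuous fun p : Matrix m m ℂ × Matrix n n ℂ => p.1 ⊗ₖ p.2 := by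
  refine continuous_matrix fun i j => ?_
  simp only [kroneckerMap_apply]
  fun_prop

theorem continuous_crossConcurrence : Continuous crossConcurrence := by
  unfold crossConcurrence
  fun_prop

theorem continuous_localFrame :
    Continuous fun p : (Matrix (Fin 2) (Fin 2) ℂ × Matrix (Fin 2) (Fin 2) ℂ) × Matrix Idx Idx ℂ =>
      localFrame p.1.1 p.1.2 p.2 := by
  unfold localFrame
  have h : Continuous fun p : (Matrix (Fin 2) (Fin 2) ℂ × Matrix (Fin 2) (Fin 2) ℂ) ×
      Matrix Idx Idx ℂ => p.1.1 ⊗ₖ p.1.2 := continuous_kronecker.comp continuous_fst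
  exact (h.matrix_conjTranspose.matrix_mul continuous_snd).matrix_mul h

/-- Simultaneous Takagi factorization and optimal local frame for limits of invertible matrices. -/
theorem exists_localFrame_of_tendsto {T : Matrix Idx (Fin 4) ℂ} {Ts : ℕ → Matrix Idx (Fin 4) ℂ}
    (hlim : Tendsto Ts atTop (𝓝 T))
    (hunit : ∀ n, IsUnit ((Ts n)ᵀ * (pauliY ⊗ₖ pauliY) * Ts n)) :
    ∃ W ∈ unitaryGroup (Fin 4) ℂ, ∃ U ∈ unitaryGroup (Fin 2) ℂ, ∃ V ∈ unitaryGroup (Fin 2) ℂ,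
      ∃ lam : Fin 4 → ℝ, Antitone lam ∧ (∀ i, 0 ≤ lam i) ∧
        (T * W)ᵀ * (pauliY ⊗ₖ pauliY) * (T * W) = (diagonal fun i => (lam i : ℂ)) ∧
        lam 0 - lam 1 - lam 2 - lam 3 ≤ crossConcurrence (localFrame U V (T * Tᴴ)) := by
  choose W hW U hU V hV l hl1 hl2 hl3 hl4 using fun n => exists_localFrame_of_isUnit (hunit n)
  clear hunit
  generalize pauliY ⊗ₖ pauliY = P at hl3 ⊢
  have : ∀ m : ℕ, FirstCountableTopology (Matrix (Fin m) (Fin m) ℂ) := fun m =>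
    inferInstanceAs (FirstCountableTopology (Fin m → Fin m → ℂ))
  -- All three unitaries converge along a subsequence. The Takagi values then converge too, being
  -- diagonal entries of the transformed form, and all closed conditions pass to the limit.
  obtain ⟨⟨W', U', V'⟩, ⟨hW', hU', hV'⟩, φ, hφ, hconv⟩ :=
    ((isCompact_unitaryGroup (Fin 4)).prod
      ((isCompact_unitaryGroup (Fin 2)).prod (isCompact_unitaryGroup (Fin 2)))).tendsto_subseq
      (x := fun n => (W n, U n, V n)) fun n => ⟨hW n, hU n, hV n⟩
  have hT : Tendsto (fun n => Ts (φ n)) atTop (𝓝 T) := hlim.comp hφ.tendsto_atTop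
  have cW : Tendsto (fun n => W (φ n)) atTop (𝓝 W') := (continuous_fst.tendsto _).comp hconv
  have cUV : Tendsto (fun n => (U (φ n), V (φ n))) atTop (𝓝 (U', V')) :=
    (continuous_snd.tendsto _).comp hconv
  have cG : Tendsto (fun n => (Ts (φ n) * W (φ n))ᵀ * P * (Ts (φ n) * W (φ n)))
      atTop (𝓝 ((T * W')ᵀ * P * (T * W'))) := by
    have hc : Continuous fun p : Matrix Idx (Fin 4) ℂ × Matrix (Fin 4) (Fin 4) ℂ =>
        (p.1 * p.2)ᵀ * P * (p.1 * p.2) := by fun_prop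
    have := (hc.tendsto (T, W')).comp (hT.prodMk_nhds cW)
    simpa only [Function.comp_def] using this
  set G := (T * W')ᵀ * P * (T * W') with hG
  have cent : ∀ i j, Tendsto (fun n => (diagonal fun i => (l (φ n) i : ℂ)) i j) atTop
      (𝓝 (G i j)) := fun i j => by
    have h1 : Continuous fun M : Matrix (Fin 4) (Fin 4) ℂ => M i j := by fun_prop
    have := (h1.tendsto _).comp cG
    refine this.congr fun n => ?_
    simp only [Function.comp, hl3]
  have clam : ∀ i, Tendsto (fun n => l (φ n) i) atTop (𝓝 (G i i).re) := fun i => by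
    have := (Complex.continuous_re.tendsto _).comp (cent i i)
    simpa [Function.comp_def] using this
  refine ⟨W', hW', U', hU', V', hV', fun i => (G i i).re, ?_, ?_, ?_, ?_⟩
  · intro i j hij
    exact le_of_tendsto_of_tendsto' (clam j) (clam i) fun n => hl1 _ hij
  · intro i
    exact ge_of_tendsto' (clam i) fun n => hl2 _ i
  · ext i j
    refine tendsto_nhds_unique (cent i j) ?_
    by_cases hij : i = j
    · subst hij
      simp only [diagonal_apply_eq]
      exact (Complex.continuous_ofReal.tendsto _).comp (clam i)
    · simp only [diagonal_apply_ne _ hij]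
      exact tendsto_const_nhds
  · refine le_of_tendsto_of_tendsto' ((((clam 0).sub (clam 1)).sub (clam 2)).sub (clam 3)) ?_
      fun n => hl4 (φ n)
    have hA : Tendsto (fun n => Ts (φ n) * (Ts (φ n))ᴴ) atTop (𝓝 (T * Tᴴ)) := by
      have hc : Continuous fun T : Matrix Idx (Fin 4) ℂ => T * Tᴴ := by fun_prop
      have := (hc.tendsto T).comp hT
      simpa only [Function.comp_def] using this
    have := ((continuous_crossConcurrence.comp continuous_localFrame).tendsto
      ((U', V'), T * Tᴴ)).comp (cUV.prodMk_nhds hA)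
    simpa only [Function.comp_def] using this

/-! ### Wootters decomposition -/

theorem pauliY_kronecker_mul_self : (pauliY ⊗ₖ pauliY) * (pauliY ⊗ₖ pauliY) = 1 := by
  have : pauliY * pauliY = 1 := by
    ext i j; fin_cases i <;> fin_cases j <;> simp [pauliY]
  rw [← mul_kronecker_mul, this, one_kronecker_one]

theorem pauliY_kronecker_conjTranspose : (pauliY ⊗ₖ pauliY)ᴴ = pauliY ⊗ₖ pauliY := by
  rw [conjTranspose_kronecker, pauliY_conjTranspose]

/-- A decreasing family of nonnegative numbers whose squares are the roots of the characteristic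
polynomial of `√ρ ρ̃ √ρ` is the family of Wootters values. -/
theorem woottersValue_eq (ρ : State) {lam : Fin 4 → ℝ} (hanti : Antitone lam)
    (hnn : ∀ i, 0 ≤ lam i)
    (hroots : (woottersMatrix ρ).charpoly.roots =
      Finset.univ.val.map fun i : Fin 4 => ((lam i ^ 2 : ℝ) : ℂ)) :
    woottersValue ρ = lam := by
  have h1 := (woottersMatrix_isHermitian ρ).sort_roots_charpoly_eq_eigenvalues₀
  have hanti2 : Antitone fun i => lam i ^ 2 := fun i j hij =>
    pow_le_pow_left₀ (hnn j) (hanti hij) 2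
  have hre : (woottersMatrix ρ).charpoly.roots.map RCLike.re =
      Finset.univ.val.map fun i : Fin 4 => lam i ^ 2 := by
    rw [hroots, Multiset.map_map]
    exact Multiset.map_congr rfl fun i _ => Complex.ofReal_re _
  have h2 : (((woottersMatrix ρ).charpoly.roots.map RCLike.re).sort (· ≥ ·)) =
      List.ofFn fun i => lam i ^ 2 := by
    simp_rw [hre, Fin.univ_val_map, Multiset.coe_sort]
    apply List.mergeSort_of_pairwise
    simp_rw [decide_eq_true_eq, ← List.sortedGE_iff_pairwise]
    exact hanti2.sortedGE_ofFn
  rw [h2] at h1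
  ext k
  have h3 : (woottersMatrix_isHermitian ρ).eigenvalues₀ (Fin.cast (by simp) k) = lam k ^ 2 := by
    have := congrArg (fun L : List ℝ => L[k.1]?) h1
    simp only [List.getElem?_ofFn] at this
    have hk : k.1 < Fintype.card Idx := by simp
    simp only [k.2, hk, dif_pos, Option.some.injEq] at this
    exact this.symm
  rw [woottersValue, h3, Real.sqrt_sq (hnn k)]

theorem roots_charpoly_diagonal {n : Type*} [Fintype n] [DecidableEq n] (d : n → ℂ) :
    (diagonal d).charpoly.roots = Finset.univ.val.map d := by
  rw [charpoly_diagonal, Polynomial.roots_prod]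
  · simp
  · simp [Finset.prod_ne_zero_iff, Polynomial.X_sub_C_ne_zero]

/-- Wootters' decomposition of a state into orthogonal vectors for the spin-flip form, together
with a local frame in which the X-shaped part is at least as entangled as the state. -/
theorem exists_wootters_decomposition (ρ : State) :
    Antitone (woottersValue ρ) ∧ (∀ i, 0 ≤ woottersValue ρ i) ∧
    (∃ X : Matrix Idx (Fin 4) ℂ, ρ.mat = X * Xᴴ ∧
      Xᵀ * (pauliY ⊗ₖ pauliY) * X = diagonal fun i => (woottersValue ρ i : ℂ)) ∧
    ∃ U ∈ unitaryGroup (Fin 2) ℂ, ∃ V ∈ unitaryGroup (Fin 2) ℂ,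
      woottersValue ρ 0 - woottersValue ρ 1 - woottersValue ρ 2 - woottersValue ρ 3 ≤
        crossConcurrence (localFrame U V ρ.mat) := by
  obtain ⟨e⟩ : Nonempty (Fin 4 ≃ Idx) := ⟨Fintype.equivOfCardEq (by simp)⟩
  set S := CFC.sqrt ρ.mat with hS
  have hSS : S * S = ρ.mat := CFC.sqrt_mul_sqrt_self ρ.mat ρ.posSemidef.nonneg
  have hSp : S.PosSemidef := nonneg_iff_posSemidef.1 (CFC.sqrt_nonneg ρ.mat)
  have hSH : Sᴴ = S := hSp.isHermitian
  set T : Matrix Idx (Fin 4) ℂ := S.submatrix id e with hT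
  -- Adding a small positive multiple of the identity makes $\sqrt\rho$ positive definite, and hence
  -- the spin-flip form invertible.
  set ε : ℕ → ℂ := fun n => ((1 / ((n : ℝ) + 1) : ℝ) : ℂ) with hε
  have hεlim : Tendsto ε atTop (𝓝 0) := by
    have := (Complex.continuous_ofReal.tendsto _).comp
      (tendsto_one_div_add_atTop_nhds_zero_nat (𝕜 := ℝ))
    simpa [Function.comp_def, hε] using this
  have hlim : Tendsto (fun n => (S + ε n • (1 : Matrix Idx Idx ℂ)).submatrix id e) atTop (𝓝 T) := by
    have hc : Continuous fun z : ℂ => (S + z • (1 : Matrix Idx Idx ℂ)).submatrix id e := by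
      fun_prop
    have := (hc.tendsto 0).comp hεlim
    simpa [Function.comp_def, hT] using this
  have hunit : ∀ n, IsUnit (((S + ε n • (1 : Matrix Idx Idx ℂ)).submatrix id e)ᵀ *
      (pauliY ⊗ₖ pauliY) * (S + ε n • (1 : Matrix Idx Idx ℂ)).submatrix id e) := fun n => by
    have hpd : (S + ε n • (1 : Matrix Idx Idx ℂ)).PosDef := by
      refine PosDef.posSemidef_add hSp (PosDef.one.smul ?_)
      rw [hε]
      exact Complex.zero_lt_real.2 (by positivity)
    have hu := (isUnit_iff_isUnit_det _).1 hpd.isUnit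
    have hP : IsUnit (pauliY ⊗ₖ pauliY).det :=
      IsUnit.of_mul_eq_one _ (by rw [← det_mul, pauliY_kronecker_mul_self, det_one])
    set R := S + ε n • (1 : Matrix Idx Idx ℂ)
    have hsub : (R.submatrix id e)ᵀ * (pauliY ⊗ₖ pauliY) * R.submatrix id e =
        (Rᵀ * (pauliY ⊗ₖ pauliY) * R).submatrix e e := rfl
    rw [hsub, isUnit_iff_isUnit_det, det_submatrix_equiv_self, det_mul, det_mul, det_transpose]
    exact (hu.mul hP).mul hu
  obtain ⟨W, hW, U, hU, V, hV, lam, hanti, hnn, hdiag, hle⟩ :=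
    exists_localFrame_of_tendsto hlim hunit
  have hTT : T * Tᴴ = ρ.mat := by
    have : T * Tᴴ = S * Sᴴ := by
      ext a b
      simp only [hT, Matrix.mul_apply, submatrix_apply, id, conjTranspose_apply]
      exact e.sum_comp fun x => S a x * star (S b x)
    rw [this, hSH, hSS]
  have hWW : W * Wᴴ = 1 := mem_unitaryGroup_iff.1 hW
  have hWW' : Wᵀᴴ * Wᵀ = 1 := by
    have := congrArg transpose hWW
    rw [transpose_mul, transpose_one] at this
    exact this
  have hlam : woottersValue ρ = lam := by
    apply woottersValue_eq ρ hanti hnn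
    -- This exhibits $\sqrt\rho\tilde\rho\sqrt\rho$ as $\tau^\dagger\tau$ for $\tau=T^{\mathsf
    -- T}(\sigma_y\otimes\sigma_y)T$, so its eigenvalues are the squares of the Takagi values of
    -- $\tau$.
    have h1 : (woottersMatrix ρ).submatrix e e =
        Tᴴ * (pauliY ⊗ₖ pauliY) * (Tᵀᴴ * Tᵀ) * (pauliY ⊗ₖ pauliY) * T := by
      have h2 : Tᵀᴴ * Tᵀ = ρ.mat.map star := by
        rw [← hTT]
        ext a b
        simp [Matrix.mul_apply]
      have h3 : Tᴴ = S.submatrix e id := by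
        conv_rhs => rw [← hSH]
        rfl
      rw [h2, h3, woottersMatrix, spinFlip]
      simp only [← hS, ← Matrix.mul_assoc]
      rfl
    have h4 : Wᴴ * (woottersMatrix ρ).submatrix e e * W =
        diagonal fun i => ((lam i ^ 2 : ℝ) : ℂ) := by
      have h5 := congrArg (fun M => Mᴴ * M) hdiag
      simp only [conjTranspose_mul, transpose_mul, pauliY_kronecker_conjTranspose] at h5
      rw [diagonal_conjTranspose, diagonal_mul_diagonal] at h5
      rw [h1]
      calc _ = Wᴴ * Tᴴ * ((pauliY ⊗ₖ pauliY) *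
              (Tᵀᴴ * (Wᵀᴴ * Wᵀ) * Tᵀ * (pauliY ⊗ₖ pauliY) * (T * W))) := by
            rw [hWW', Matrix.mul_one]
            simp only [Matrix.mul_assoc]
        _ = _ := by
            simp only [Matrix.mul_assoc] at h5 ⊢
            rw [h5]
            congr 1; ext i
            simp [sq]
    have h6 : (woottersMatrix ρ).charpoly = (diagonal fun i => ((lam i ^ 2 : ℝ) : ℂ)).charpoly := by
      rw [← h4, Matrix.mul_assoc, charpoly_mul_comm, Matrix.mul_assoc, hWW, Matrix.mul_one]
      exact (charpoly_reindex e.symm _).symm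
    rw [h6, roots_charpoly_diagonal]
  rw [hlam]
  refine ⟨hanti, hnn, ⟨T * W, ?_, hdiag⟩, U, hU, V, hV, ?_⟩
  · rw [conjTranspose_mul, Matrix.mul_assoc, ← Matrix.mul_assoc W, hWW, Matrix.one_mul, hTT]
  · rwa [hTT] at hle

/-! ### The concurrence bounds the form -/

/-- If the largest length exceeds the sum of the others, aligning those three against it is enough;
otherwise the four lengths close up to a planar polygon. -/
theorem exists_phases {w : Fin 4 → ℝ} (hw : Antitone w) (hnn : ∀ i, 0 ≤ w i) :
    ∃ u : Fin 4 → ℂ, (∀ i, ‖u i‖ = 1) ∧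
      ‖∑ i, u i * w i‖ ≤ max 0 (w 0 - w 1 - w 2 - w 3) := by
  rcases le_total 0 (w 0 - w 1 - w 2 - w 3) with h | h
  · refine ⟨![1, -1, -1, -1], fun i => by fin_cases i <;> simp, ?_⟩
    rw [max_eq_right h, Fin.sum_univ_four]
    have : (![1, -1, -1, -1] : Fin 4 → ℂ) 0 * w 0 + (![1, -1, -1, -1] : Fin 4 → ℂ) 1 * w 1
        + (![1, -1, -1, -1] : Fin 4 → ℂ) 2 * w 2 + (![1, -1, -1, -1] : Fin 4 → ℂ) 3 * w 3
        = ((w 0 - w 1 - w 2 - w 3 : ℝ) : ℂ) := by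
      simp
      ring
    rw [this, Complex.norm_real, Real.norm_of_nonneg h]
  · have h01 : w 1 ≤ w 0 := hw (by decide)
    have h12 : w 2 ≤ w 0 := hw (by decide)
    have h23 : w 3 ≤ w 1 := hw (by decide)
    have hcont : Continuous fun θ : ℝ => ‖(w 0 : ℂ) + Complex.exp (θ * Complex.I) * w 1‖ := by
      fun_prop
    -- Turning the second side moves the length of the sum of the first two continuously between
    -- $w_0-w_1$ and $w_0+w_1$; at the value $w_2+w_3$ the last two sides, taken parallel, close the
    -- polygon.
    have hmem : w 2 + w 3 ∈ Set.Icc ‖(w 0 : ℂ) + Complex.exp ((Real.pi : ℝ) * Complex.I) * w 1‖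
        ‖(w 0 : ℂ) + Complex.exp ((0 : ℝ) * Complex.I) * w 1‖ := by
      constructor
      · rw [Complex.exp_pi_mul_I]
        have : (w 0 : ℂ) + -1 * w 1 = ((w 0 - w 1 : ℝ) : ℂ) := by push_cast; ring
        rw [this, Complex.norm_real, Real.norm_of_nonneg (by linarith)]
        linarith
      · have : (w 0 : ℂ) + Complex.exp ((0 : ℝ) * Complex.I) * w 1 = ((w 0 + w 1 : ℝ) : ℂ) := by
          simp
        rw [this, Complex.norm_real, Real.norm_of_nonneg (add_nonneg (hnn 0) (hnn 1))]
        linarith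
    obtain ⟨θ, -, hθ⟩ := intermediate_value_Icc' Real.pi_pos.le hcont.continuousOn hmem
    simp only at hθ
    set z := (w 0 : ℂ) + Complex.exp (θ * Complex.I) * w 1 with hz
    have hexp : ‖Complex.exp (θ * Complex.I)‖ = 1 := Complex.norm_exp_ofReal_mul_I θ
    obtain ⟨c, hc1, hc⟩ : ∃ c : ℂ, ‖c‖ = 1 ∧ z + c * (w 2 + w 3 : ℝ) = 0 := by
      by_cases h0 : z = 0
      · refine ⟨1, norm_one, ?_⟩
        rw [h0, norm_zero] at hθ
        rw [h0, ← hθ]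
        simp
      · have hn : (‖z‖ : ℂ) ≠ 0 := by exact_mod_cast norm_ne_zero_iff.2 h0
        refine ⟨-(z / ‖z‖), ?_, ?_⟩
        · rw [norm_neg, norm_div, Complex.norm_real, norm_norm, div_self (norm_ne_zero_iff.2 h0)]
        · rw [← hθ]
          field_simp
          ring
    refine ⟨![1, Complex.exp (θ * Complex.I), c, c], fun i => by
      fin_cases i <;> simp [hexp, hc1], ?_⟩
    rw [Fin.sum_univ_four]
    have : (![1, Complex.exp (θ * Complex.I), c, c] : Fin 4 → ℂ) 0 * w 0
        + (![1, Complex.exp (θ * Complex.I), c, c] : Fin 4 → ℂ) 1 * w 1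
        + (![1, Complex.exp (θ * Complex.I), c, c] : Fin 4 → ℂ) 2 * w 2
        + (![1, Complex.exp (θ * Complex.I), c, c] : Fin 4 → ℂ) 3 * w 3 = 0 := by
      rw [← hc, hz]
      simp
      ring
    rw [this, norm_zero]
    exact le_max_left _ _

/-- A `4 × 4` real orthogonal matrix all of whose entries are `± 1 / 2`. -/
noncomputable def hadamardFour : Matrix (Fin 4) (Fin 4) ℂ :=
  (1 / 2 : ℂ) • !![1, 1, 1, 1; 1, 1, -1, -1; 1, -1, 1, -1; 1, -1, -1, 1]

theorem hadamardFour_mul_conjTranspose : hadamardFour * hadamardFourᴴ = 1 := by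
  ext i j
  fin_cases i <;> fin_cases j <;>
    simp [hadamardFour, Matrix.mul_apply, Fin.sum_univ_four, Complex.conj_ofNat] <;> norm_num

theorem hadamardFour_mul_self_apply (i j : Fin 4) :
    hadamardFour i j * hadamardFour i j = 1 / 4 := by
  fin_cases i <;> fin_cases j <;> norm_num [hadamardFour]

/-- The concurrence bounds the negative part of the partial transpose. -/
theorem neg_ptForm_le_concurrence (ρ : State) (v : Idx → ℂ) :
    -ptForm ρ.mat v ≤ concurrence ρ * ‖vecDet v‖ := by
  obtain ⟨hanti, hnn, ⟨X, hX, hdiag⟩, -⟩ := exists_wootters_decomposition ρ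
  obtain ⟨u, hu, hle⟩ := exists_phases hanti hnn
  -- Square roots of the phases, because the spin-flip form is bilinear and each column's factor
  -- enters twice.
  choose p hp using fun i => IsAlgClosed.exists_pow_nat_eq (u i) (n := 2) two_pos
  have hpn : ∀ i, ‖p i‖ = 1 := fun i => by
    have := congrArg (‖·‖) (hp i)
    simp only [norm_pow, hu] at this
    nlinarith [norm_nonneg (p i)]
  have hpp : (diagonal p) * (diagonal p)ᴴ = 1 := by
    rw [diagonal_conjTranspose, diagonal_mul_diagonal, ← diagonal_one]
    congr 1; ext i
    have := Complex.mul_conj' (p i)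
    rw [hpn] at this
    simpa using this
  -- All squared entries of `hadamardFour` equal $1/4$, so every column of `Y` has the same
  -- spin-flip value, a quarter of the phased sum. The rank-one bounds therefore add up to $C$
  -- without loss.
  set Y := X * diagonal p * hadamardFour with hY
  have hYY : ρ.mat = Y * Yᴴ := by
    rw [hX, hY, conjTranspose_mul, conjTranspose_mul]
    calc X * Xᴴ = X * (diagonal p * (hadamardFour * hadamardFourᴴ) * (diagonal p)ᴴ) * Xᴴ := by
          rw [hadamardFour_mul_conjTranspose, Matrix.mul_one, hpp, Matrix.mul_one]
      _ = _ := by simp only [Matrix.mul_assoc]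
  have hdet : ∀ i, 2 * ‖vecDet (Yᵀ i)‖ = ‖∑ j, u j * woottersValue ρ j‖ / 4 := fun i => by
    have h1 := transpose_mul_spinFlip_mul_apply Y i i
    rw [polarDet_self, det_coeffMatrix] at h1
    have h2 : Yᵀ * (pauliY ⊗ₖ pauliY) * Y =
        hadamardFourᵀ * (diagonal fun j => u j * woottersValue ρ j) * hadamardFour := by
      have h3 : (diagonal p) * (diagonal fun i => (woottersValue ρ i : ℂ)) * diagonal p =
          diagonal fun j => u j * woottersValue ρ j := by
        rw [diagonal_mul_diagonal, diagonal_mul_diagonal]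
        congr 1; ext j
        rw [← hp]
        ring
      rw [← h3, ← hdiag, hY, transpose_mul, transpose_mul, diagonal_transpose]
      simp only [Matrix.mul_assoc]
    have h4 : (hadamardFourᵀ * (diagonal fun j => u j * (woottersValue ρ j : ℂ)) *
        hadamardFour) i i = (∑ j, u j * woottersValue ρ j) / 4 := by
      rw [Matrix.mul_apply, Finset.sum_div]
      refine Finset.sum_congr rfl fun j _ => ?_
      rw [mul_diagonal, transpose_apply]
      linear_combination (u j * woottersValue ρ j) * hadamardFour_mul_self_apply j i
    rw [h2, h4] at h1
    have h5 := congrArg (‖·‖) h1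
    simp only [norm_neg, norm_mul, norm_div] at h5
    norm_num at h5
    linarith
  rw [hYY, mul_conjTranspose_eq_sum_proj, ptForm_sum, ← Finset.sum_neg_distrib]
  calc ∑ i, -ptForm (proj (Yᵀ i)) v
      ≤ ∑ i : Fin 4, ‖∑ j, u j * woottersValue ρ j‖ / 4 * ‖vecDet v‖ :=
        Finset.sum_le_sum fun i _ => (neg_ptForm_proj_le _ v).trans_eq (by rw [hdet])
    _ = ‖∑ j, u j * woottersValue ρ j‖ * ‖vecDet v‖ := by
        simp only [Finset.sum_const, Finset.card_univ, Fintype.card_fin, nsmul_eq_mul]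
        push_cast
        ring
    _ ≤ concurrence ρ * ‖vecDet v‖ :=
        mul_le_mul_of_nonneg_right hle (norm_nonneg _)

/-- In a suitable local frame the X-shaped part carries all of the concurrence. -/
theorem exists_concurrence_le_crossConcurrence (ρ : State) (hC : 0 < concurrence ρ) :
    ∃ U ∈ unitaryGroup (Fin 2) ℂ, ∃ V ∈ unitaryGroup (Fin 2) ℂ,
      concurrence ρ ≤ crossConcurrence (localFrame U V ρ.mat) := by
  obtain ⟨-, -, -, U, hU, V, hV, h⟩ := exists_wootters_decomposition ρ
  refine ⟨U, hU, V, hV, ?_⟩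
  rw [concurrence] at hC ⊢
  rcases le_total (woottersValue ρ 0 - woottersValue ρ 1 - woottersValue ρ 2 - woottersValue ρ 3) 0
    with h0 | h0
  · rw [max_eq_left h0] at hC
    exact absurd hC (lt_irrefl _)
  · rwa [max_eq_right h0]

/-! ### Negativity and the unique negative eigenvalue -/

/-- The squared Euclidean norm of a two-qubit vector. -/
noncomputable def vecNormSq (v : Idx → ℂ) : ℝ := ∑ a, ‖v a‖ ^ 2

theorem star_dotProduct_self (v : Idx → ℂ) : star v ⬝ᵥ v = (vecNormSq v : ℂ) := by
  simp only [dotProduct, vecNormSq, Pi.star_apply, Complex.ofReal_sum]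
  refine Finset.sum_congr rfl fun a _ => ?_
  rw [mul_comm]
  simpa using Complex.mul_conj' (v a)

theorem vecNormSq_eq (v : Idx → ℂ) :
    vecNormSq v = ‖v (0, 0)‖ ^ 2 + ‖v (0, 1)‖ ^ 2 + ‖v (1, 0)‖ ^ 2 + ‖v (1, 1)‖ ^ 2 := by
  simp [vecNormSq, Fintype.sum_prod_type, Fin.sum_univ_two]
  ring

theorem vecNormSq_pos {v : Idx → ℂ} (hv : v ≠ 0) : 0 < vecNormSq v := by
  obtain ⟨a, ha⟩ := Function.ne_iff.1 hv
  exact Finset.sum_pos' (fun _ _ => sq_nonneg _)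
    ⟨a, Finset.mem_univ a, pow_pos (norm_pos_iff.2 ha) 2⟩

theorem norm_vecDet_le (v : Idx → ℂ) : ‖vecDet v‖ ≤ vecNormSq v / 2 := by
  have h := norm_sub_le (v (0, 0) * v (1, 1)) (v (0, 1) * v (1, 0))
  rw [norm_mul, norm_mul] at h
  rw [vecDet, vecNormSq_eq]
  nlinarith [sq_nonneg (‖v (0, 0)‖ - ‖v (1, 1)‖), sq_nonneg (‖v (0, 1)‖ - ‖v (1, 0)‖)]

theorem vecDet_add (v w : Idx → ℂ) :
    vecDet (v + w) = vecDet v + polarDet (coeffMatrix v) (coeffMatrix w) + vecDet w := by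
  simp [vecDet, polarDet, coeffMatrix]
  ring

theorem vecDet_smul (c : ℂ) (v : Idx → ℂ) : vecDet (c • v) = c ^ 2 * vecDet v := by
  simp [vecDet]
  ring

theorem ptForm_of_eigenvector {A : Matrix Idx Idx ℂ} {μ : ℝ} {v : Idx → ℂ}
    (hv : partialTranspose A *ᵥ v = (μ : ℂ) • v) : ptForm A v = μ * vecNormSq v := by
  rw [ptForm, hv, dotProduct_smul, star_dotProduct_self, smul_eq_mul, ← Complex.ofReal_mul,
    Complex.ofReal_re]

theorem star_dotProduct_mulVec_of_eigenvector {M : Matrix Idx Idx ℂ} (hM : M.IsHermitian) {μ : ℝ}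
    {v : Idx → ℂ} (hv : M *ᵥ v = (μ : ℂ) • v) (w : Idx → ℂ) :
    star v ⬝ᵥ M *ᵥ w = μ * (star v ⬝ᵥ w) := by
  have h : star v ᵥ* M = (μ : ℂ) • star v := by
    have := congrArg star hv
    rw [star_mulVec, hM.eq, star_smul] at this
    simpa using this
  rw [dotProduct_mulVec, h, smul_dotProduct, smul_eq_mul]

theorem ptForm_add_of_eigenvector {A : Matrix Idx Idx ℂ} (hA : A.IsHermitian) {μ : ℝ}
    {v w : Idx → ℂ} (hv : partialTranspose A *ᵥ v = (μ : ℂ) • v) (hvw : star v ⬝ᵥ w = 0) (α : ℂ) :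
    ptForm A (α • v + w) = μ * ‖α‖ ^ 2 * vecNormSq v + ptForm A w := by
  have h1 : star w ⬝ᵥ v = 0 := by
    rw [star_dotProduct, hvw, star_zero]
  have h2 := star_dotProduct_mulVec_of_eigenvector (partialTranspose_isHermitian hA) hv w
  rw [hvw, mul_zero] at h2
  have h3 : star α * α = ((‖α‖ ^ 2 : ℝ) : ℂ) := by
    rw [mul_comm]
    simpa using Complex.mul_conj' α
  rw [ptForm, ptForm]
  simp only [star_add, star_smul, mulVec_add, mulVec_smul, hv, add_dotProduct, dotProduct_add,
    smul_dotProduct, dotProduct_smul, h1, h2, star_dotProduct_self, smul_eq_mul, mul_zero, add_zero,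
    zero_add, Complex.add_re]
  congr 1
  rw [show α * ((μ : ℂ) * (star α * (vecNormSq v : ℂ))) = (star α * α) * (μ * vecNormSq v) by ring,
    h3]
  norm_cast
  ring

/-- A two-dimensional space of two-qubit vectors contains a product vector. -/
theorem exists_vecDet_eq_zero (v w : Idx → ℂ) :
    ∃ α β : ℂ, (α ≠ 0 ∨ β ≠ 0) ∧ vecDet (α • v + β • w) = 0 := by
  by_cases hv : vecDet v = 0
  · exact ⟨1, 0, Or.inl one_ne_zero, by simpa using hv⟩
  · obtain ⟨s, hs⟩ := IsAlgClosed.exists_pow_nat_eq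
      (discrim (vecDet v) (polarDet (coeffMatrix v) (coeffMatrix w)) (vecDet w)) (n := 2) two_pos
    obtain ⟨x, hx⟩ := exists_quadratic_eq_zero hv ⟨s, by rw [← hs, sq]⟩
    refine ⟨x, 1, Or.inr one_ne_zero, ?_⟩
    rw [one_smul, vecDet_add, vecDet_smul, ← hx]
    simp [polarDet, coeffMatrix]
    ring

theorem negativity_nonneg (ρ : State) : 0 ≤ negativity ρ :=
  mul_nonneg zero_le_two (Finset.sum_nonneg fun _ _ => le_max_left _ _)

/-- Each negative eigenvalue is one of the terms whose absolute values sum to $N/2$, so none lies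
below $-N/2$. -/
theorem posSemidef_partialTranspose_add (ρ : State) :
    (partialTranspose ρ.mat +
      ((negativity ρ / 2 : ℝ) : ℂ) • (1 : Matrix Idx Idx ℂ)).PosSemidef := by
  set hM := ρ.isHermitian_partialTranspose
  set V : Matrix Idx Idx ℂ := hM.eigenvectorUnitary.1 with hV
  have hVu : V * Vᴴ = 1 := mem_unitaryGroup_iff.1 hM.eigenvectorUnitary.2
  have hspec : partialTranspose ρ.mat = V * (diagonal fun i => (hM.eigenvalues i : ℂ)) * Vᴴ :=
    hM.spectral_theorem
  have : partialTranspose ρ.mat + ((negativity ρ / 2 : ℝ) : ℂ) • (1 : Matrix Idx Idx ℂ) =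
      V * (diagonal fun i => ((hM.eigenvalues i + negativity ρ / 2 : ℝ) : ℂ)) * Vᴴ := by
    have h2 : (diagonal fun i => ((hM.eigenvalues i + negativity ρ / 2 : ℝ) : ℂ)) =
        (diagonal fun i => (hM.eigenvalues i : ℂ)) +
          ((negativity ρ / 2 : ℝ) : ℂ) • (1 : Matrix Idx Idx ℂ) := by
      rw [smul_one_eq_diagonal, diagonal_add]
      simp
    rw [h2, Matrix.mul_add, Matrix.add_mul, ← hspec, Matrix.mul_smul, Matrix.smul_mul,
      Matrix.mul_one, hVu]
  rw [this]
  refine PosSemidef.mul_mul_conjTranspose_same (PosSemidef.diagonal fun i => ?_) V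
  have h1 : max 0 (-(hM.eigenvalues i)) ≤ ∑ j, max 0 (-(hM.eigenvalues j)) :=
    Finset.single_le_sum (f := fun j => max 0 (-(hM.eigenvalues j)))
      (fun _ _ => le_max_left _ _) (Finset.mem_univ i)
  have h2 : negativity ρ = 2 * ∑ j, max 0 (-(hM.eigenvalues j)) := rfl
  have h3 := le_max_right 0 (-(hM.eigenvalues i))
  exact Complex.zero_le_real.2 (by linarith)

theorem star_dotProduct_partialTranspose_add (ρ : State) (v : Idx → ℂ) :
    (star v ⬝ᵥ (partialTranspose ρ.mat + ((negativity ρ / 2 : ℝ) : ℂ) •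
      (1 : Matrix Idx Idx ℂ)) *ᵥ v).re = ptForm ρ.mat v + negativity ρ / 2 * vecNormSq v := by
  rw [add_mulVec, smul_mulVec, one_mulVec, dotProduct_add, dotProduct_smul, star_dotProduct_self,
    Complex.add_re, smul_eq_mul, ← Complex.ofReal_mul, Complex.ofReal_re]
  rfl

/-- The negativity bounds the negative part of the partial transpose. -/
theorem neg_ptForm_le_negativity (ρ : State) (v : Idx → ℂ) :
    -ptForm ρ.mat v ≤ negativity ρ / 2 * vecNormSq v := by
  have h := (posSemidef_partialTranspose_add ρ).dotProduct_mulVec_nonneg v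
  have h2 := (Complex.le_def.1 h).1
  rw [star_dotProduct_partialTranspose_add] at h2
  simp at h2
  linarith

/-- A vector attaining the bound is isotropic for the positive semidefinite matrix
$\rho^\Gamma+N/2$, hence in its kernel. -/
theorem partialTranspose_mulVec_of_ptForm_eq (ρ : State) {v : Idx → ℂ}
    (hv : ptForm ρ.mat v = -(negativity ρ / 2) * vecNormSq v) :
    partialTranspose ρ.mat *ᵥ v = ((-(negativity ρ / 2) : ℝ) : ℂ) • v := by
  have hp := posSemidef_partialTranspose_add ρ
  have h0 : star v ⬝ᵥ (partialTranspose ρ.mat + ((negativity ρ / 2 : ℝ) : ℂ) •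
      (1 : Matrix Idx Idx ℂ)) *ᵥ v = 0 := by
    apply Complex.ext
    · rw [star_dotProduct_partialTranspose_add, hv]
      simp
    · exact ((Complex.le_def.1 (hp.dotProduct_mulVec_nonneg v)).2).symm
  have h1 := (hp.dotProduct_mulVec_zero_iff v).1 h0
  rw [add_mulVec, smul_mulVec, one_mulVec] at h1
  rw [eq_neg_of_add_eq_zero_left h1]
  push_cast
  rw [neg_smul]

/-- Two eigenvectors of the partial transpose with negative eigenvalues are parallel. -/
theorem eigenvector_unique (ρ : State) {μ ν : ℝ} {v w : Idx → ℂ} (hμ : μ < 0) (hν : ν < 0)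
    (hv1 : star v ⬝ᵥ v = 1) (hw0 : w ≠ 0) (hv : partialTranspose ρ.mat *ᵥ v = (μ : ℂ) • v)
    (hw : partialTranspose ρ.mat *ᵥ w = (ν : ℂ) • w) : ν = μ ∧ ∃ c : ℂ, w = c • v := by
  have hH := ρ.posSemidef.isHermitian
  set c := star v ⬝ᵥ w with hc
  -- Either `c = 0` or the eigenvalues agree; in both cases the component of `w` orthogonal to `v`
  -- is still an eigenvector for `ν`.
  have hcc : c * μ = c * ν := by
    have h1 := star_dotProduct_mulVec_of_eigenvector ρ.isHermitian_partialTranspose hv w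
    rw [hw, dotProduct_smul, ← hc, smul_eq_mul] at h1
    rw [mul_comm, ← h1, mul_comm]
  set w' := w - c • v with hw'
  have horth : star v ⬝ᵥ w' = 0 := by
    rw [hw', dotProduct_sub, dotProduct_smul, hv1, ← hc, smul_eq_mul, mul_one, sub_self]
  have hew : partialTranspose ρ.mat *ᵥ w' = (ν : ℂ) • w' := by
    rw [hw', mulVec_sub, mulVec_smul, hw, hv, smul_sub, smul_smul, smul_smul, hcc, mul_comm c]
  have hw'0 : w' = 0 := by
    by_contra hne
    -- On a product vector in this plane the form is nonnegative by the concurrence bound, yet it is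
    -- $\mu|\alpha|^2+\nu|\beta|^2\|w'\|^2<0$.
    obtain ⟨α, β, hαβ, hdet⟩ := exists_vecDet_eq_zero v w'
    have h1 := neg_ptForm_le_concurrence ρ (α • v + β • w')
    rw [hdet, norm_zero, mul_zero, ptForm_add_of_eigenvector hH hv
      (by rw [dotProduct_smul, horth, smul_zero])] at h1
    have h2 : ptForm ρ.mat (β • w') = ν * ‖β‖ ^ 2 * vecNormSq w' := by
      have := ptForm_add_of_eigenvector hH hew (dotProduct_zero _) β
      rw [add_zero] at this
      rw [this]
      simp [ptForm]
    have h3 : vecNormSq v = 1 := by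
      rw [star_dotProduct_self] at hv1
      exact_mod_cast hv1
    rw [h2, h3] at h1
    have h4 := vecNormSq_pos hne
    rcases hαβ with h | h
    · have h5 := mul_pos (neg_pos.2 hμ) (pow_pos (norm_pos_iff.2 h) 2)
      have h6 := mul_nonneg (mul_nonneg (neg_pos.2 hν).le (sq_nonneg ‖β‖)) h4.le
      linarith
    · have h5 := mul_nonneg (neg_pos.2 hμ).le (sq_nonneg ‖α‖)
      have h6 := mul_pos (mul_pos (neg_pos.2 hν) (pow_pos (norm_pos_iff.2 h) 2)) h4
      linarith
  have hwc : w = c • v := sub_eq_zero.1 hw'0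
  refine ⟨?_, c, hwc⟩
  have hc0 : c ≠ 0 := fun h => hw0 (by rw [hwc, h, zero_smul])
  exact_mod_cast (mul_left_cancel₀ hc0 hcc).symm

/-- The negative eigenvalue of the partial transpose of a state with nonzero negativity. -/
theorem exists_negative_eigenvalue (ρ : State) (hN : 0 < negativity ρ) :
    ∃ (μ : ℝ) (v : Idx → ℂ), μ < 0 ∧ star v ⬝ᵥ v = 1 ∧
      partialTranspose ρ.mat *ᵥ v = (μ : ℂ) • v ∧ negativity ρ = 2 * |μ| := by
  set hM := ρ.isHermitian_partialTranspose
  have hdef : negativity ρ = 2 * ∑ j, max 0 (-(hM.eigenvalues j)) := rfl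
  obtain ⟨i, hi⟩ : ∃ i, hM.eigenvalues i < 0 := by
    by_contra! h
    rw [hdef, Finset.sum_eq_zero fun j _ => max_eq_left (neg_nonpos.2 (h j))] at hN
    simp at hN
  have hev : ∀ j, partialTranspose ρ.mat *ᵥ (hM.eigenvectorBasis j).ofLp =
      (hM.eigenvalues j : ℂ) • (hM.eigenvectorBasis j).ofLp := fun j =>
    hM.mulVec_eigenvectorBasis j
  have hin : ∀ j k, star (hM.eigenvectorBasis j).ofLp ⬝ᵥ (hM.eigenvectorBasis k).ofLp =
      if j = k then 1 else 0 := fun j k => by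
    have := orthonormal_iff_ite.1 hM.eigenvectorBasis.orthonormal j k
    rw [← this, EuclideanSpace.inner_eq_star_dotProduct, dotProduct_comm]
  have hone : star (hM.eigenvectorBasis i).ofLp ⬝ᵥ (hM.eigenvectorBasis i).ofLp = 1 := by
    rw [hin, if_pos rfl]
  refine ⟨hM.eigenvalues i, (hM.eigenvectorBasis i).ofLp, hi, hone, hev i, ?_⟩
  rw [hdef, abs_of_neg hi, Finset.sum_eq_single i, max_eq_right (neg_nonneg.2 hi.le)]
  -- A second negative eigenvalue would have a basis eigenvector parallel to the `i`-th one, against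
  -- orthonormality.
  · intro j _ hji
    rw [max_eq_left]
    by_contra! h
    have hj0 : (hM.eigenvectorBasis j).ofLp ≠ 0 := fun h0 => by
      have := hin j j
      rw [h0, if_pos rfl, dotProduct_zero] at this
      exact zero_ne_one this
    obtain ⟨-, c, hc⟩ := eigenvector_unique ρ hi (neg_pos.1 h) hone hj0 (hev i) (hev j)
    have h1 := hin i j
    rw [hc, dotProduct_smul, hone, if_neg (Ne.symm hji), smul_eq_mul, mul_one] at h1
    exact hj0 (by rw [hc, h1, zero_smul])
  · intro h
    exact absurd (Finset.mem_univ i) h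

/-- The negativity is at most the concurrence. -/
theorem negativity_le_concurrence (ρ : State) : negativity ρ ≤ concurrence ρ := by
  rcases (negativity_nonneg ρ).eq_or_lt with h | h
  · rw [← h]
    exact le_max_left _ _
  · obtain ⟨μ, v, hμ, hv1, hv, hN⟩ := exists_negative_eigenvalue ρ h
    have hn : vecNormSq v = 1 := by
      rw [star_dotProduct_self] at hv1
      exact_mod_cast hv1
    have h1 := neg_ptForm_le_concurrence ρ v
    rw [ptForm_of_eigenvector hv, hn] at h1
    have h2 := norm_vecDet_le v
    rw [hn] at h2
    have hC : 0 ≤ concurrence ρ := le_max_left _ _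
    rw [hN, abs_of_neg hμ]
    nlinarith

/-! ### Local unitary invariance and antidiagonal test vectors -/

theorem map_star_mem_unitaryGroup {n : Type*} [Fintype n] [DecidableEq n] {V : Matrix n n ℂ}
    (hV : V ∈ unitaryGroup n ℂ) : V.map star ∈ unitaryGroup n ℂ := by
  rw [mem_unitaryGroup_iff] at hV ⊢
  have := congrArg transpose hV
  rw [transpose_mul, transpose_one] at this
  rw [← this]
  ext i j
  simp [Matrix.mul_apply, mul_comm]

theorem vecNormSq_mulVec {P : Matrix Idx Idx ℂ} (hP : P ∈ unitaryGroup Idx ℂ) (v : Idx → ℂ) :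
    vecNormSq (P *ᵥ v) = vecNormSq v := by
  have h : star (P *ᵥ v) ⬝ᵥ P *ᵥ v = star v ⬝ᵥ v := by
    rw [star_mulVec, ← dotProduct_mulVec, mulVec_mulVec, ← star_eq_conjTranspose,
      mem_unitaryGroup_iff'.1 hP, one_mulVec]
  rw [star_dotProduct_self, star_dotProduct_self] at h
  exact_mod_cast h

theorem norm_vecDet_mulVec {U V : Matrix (Fin 2) (Fin 2) ℂ} (hU : U ∈ unitaryGroup (Fin 2) ℂ)
    (hV : V ∈ unitaryGroup (Fin 2) ℂ) (v : Idx → ℂ) :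
    ‖vecDet ((U ⊗ₖ V) *ᵥ v)‖ = ‖vecDet v‖ := by
  rw [← det_coeffMatrix, coeffMatrix_kronecker_mulVec, det_mul, det_mul, det_transpose, norm_mul,
    norm_mul, norm_det_of_mem_unitaryGroup hU, norm_det_of_mem_unitaryGroup hV, det_coeffMatrix]
  ring

theorem neg_ptForm_localFrame_le_concurrence (ρ : State) {U V : Matrix (Fin 2) (Fin 2) ℂ}
    (hU : U ∈ unitaryGroup (Fin 2) ℂ) (hV : V ∈ unitaryGroup (Fin 2) ℂ) (v : Idx → ℂ) :
    -ptForm (localFrame U V ρ.mat) v ≤ concurrence ρ * ‖vecDet v‖ := by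
  rw [ptForm_localFrame, ← norm_vecDet_mulVec hU (map_star_mem_unitaryGroup hV) v]
  exact neg_ptForm_le_concurrence ρ _

theorem neg_ptForm_localFrame_le_negativity (ρ : State) {U V : Matrix (Fin 2) (Fin 2) ℂ}
    (hU : U ∈ unitaryGroup (Fin 2) ℂ) (hV : V ∈ unitaryGroup (Fin 2) ℂ) (v : Idx → ℂ) :
    -ptForm (localFrame U V ρ.mat) v ≤ negativity ρ / 2 * vecNormSq v := by
  rw [ptForm_localFrame,
    ← vecNormSq_mulVec (kronecker_mem_unitary hU (map_star_mem_unitaryGroup hV)) v]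
  exact neg_ptForm_le_negativity ρ _

/-- The vector `x |01⟩ + y |10⟩`. -/
def antiVec (x y : ℂ) : Idx → ℂ := ofCoeff !![0, x; y, 0]

theorem vecNormSq_antiVec (x y : ℂ) : vecNormSq (antiVec x y) = ‖x‖ ^ 2 + ‖y‖ ^ 2 := by
  simp [vecNormSq_eq, antiVec, ofCoeff]

theorem vecDet_antiVec (x y : ℂ) : vecDet (antiVec x y) = -(x * y) := by
  simp [vecDet, antiVec, ofCoeff]

theorem exists_norm_eq_one_mul_eq (z : ℂ) : ∃ ω : ℂ, ‖ω‖ = 1 ∧ ω * z = -(‖z‖ : ℂ) := by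
  by_cases h : z = 0
  · exact ⟨1, norm_one, by simp [h]⟩
  · have h1 := norm_ne_zero_iff.2 h
    have h2 : (‖z‖ : ℂ) ≠ 0 := by exact_mod_cast h1
    refine ⟨-(‖z‖ / z), ?_, ?_⟩
    · rw [norm_neg, norm_div, Complex.norm_real, norm_norm, div_self h1]
    · field_simp

/-- The relative phase is chosen so that the coherence enters as minus its modulus, which reduces
the block to a real quadratic form in two variables. -/
theorem exists_phase_ptForm_antiVec {B : Matrix Idx Idx ℂ} (hB : B.IsHermitian) :
    ∃ ω : ℂ, ‖ω‖ = 1 ∧ ∀ x y : ℝ, ptForm B (antiVec x (y * ω)) =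
      x ^ 2 * (B (0, 1) (0, 1)).re + y ^ 2 * (B (1, 0) (1, 0)).re
        - 2 * (x * y) * ‖B (0, 0) (1, 1)‖ := by
  obtain ⟨ω, hω1, hω⟩ := exists_norm_eq_one_mul_eq (B (0, 0) (1, 1))
  refine ⟨ω, hω1, fun x y => ?_⟩
  have hH : B (1, 1) (0, 0) = star (B (0, 0) (1, 1)) := (hB.apply _ _).symm
  have hωω : star ω * ω = 1 := by
    rw [mul_comm]
    have := Complex.mul_conj' ω
    rw [hω1] at this
    simpa using this
  have hω' : star ω * star (B (0, 0) (1, 1)) = -(‖B (0, 0) (1, 1)‖ : ℂ) := by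
    have := congrArg star hω
    simpa [mul_comm] using this
  rw [ptForm_antidiagonal B _ rfl rfl]
  simp only [antiVec, ofCoeff, of_apply, cons_val', cons_val_zero, cons_val_one, cons_val_fin_one]
  rw [hH]
  have : star (x : ℂ) * x * B (0, 1) (0, 1) + star (y * ω) * (y * ω) * B (1, 0) (1, 0)
      + star (x : ℂ) * (y * ω) * B (0, 0) (1, 1) + star (y * ω) * x * star (B (0, 0) (1, 1))
      = ((x ^ 2 : ℝ) : ℂ) * B (0, 1) (0, 1) + ((y ^ 2 : ℝ) : ℂ) * B (1, 0) (1, 0)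
        - ((2 * (x * y) * ‖B (0, 0) (1, 1)‖ : ℝ) : ℂ) := by
    have hx : star (x : ℂ) = x := Complex.conj_ofReal x
    have hy : star (y : ℂ) = y := Complex.conj_ofReal y
    rw [star_mul, hx, hy]
    push_cast
    linear_combination ((y : ℂ) ^ 2 * B (1, 0) (1, 0)) * hωω + (x * y : ℂ) * hω + (x * y : ℂ) * hω'
  rw [this]
  simp only [Complex.add_re, Complex.sub_re, Complex.re_ofReal_mul, Complex.ofReal_re]

theorem re_diag_nonneg {B : Matrix Idx Idx ℂ} (hB : B.PosSemidef) (a : Idx) : 0 ≤ (B a a).re :=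
  (Complex.le_def.1 (hB.diag_nonneg (i := a))).1

/-- Converse to `neg_ptForm_antidiagonal_le`: the hypothesis on antidiagonal vectors makes a real
quadratic polynomial nonnegative, and its discriminant inequality is $(2r-c)^2\le 4ab$. -/
theorem crossConcurrence_le {B : Matrix Idx Idx ℂ} (hB : B.PosSemidef) {c : ℝ}
    (h : ∀ v, -ptForm B v ≤ c * ‖vecDet v‖) : crossConcurrence B ≤ c := by
  obtain ⟨ω, hω, hf⟩ := exists_phase_ptForm_antiVec hB.isHermitian
  have ha := re_diag_nonneg hB (0, 1)
  have hb := re_diag_nonneg hB (1, 0)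
  set a := (B (0, 1) (0, 1)).re
  set b := (B (1, 0) (1, 0)).re
  set r := ‖B (0, 0) (1, 1)‖
  rw [crossConcurrence]
  rcases le_or_gt (2 * r - c) 0 with h0 | h0
  · linarith [Real.sqrt_nonneg (a * b)]
  · have hq : ∀ x : ℝ, 0 ≤ a * (x * x) + -(2 * r - c) * x + b := fun x => by
      have h1 := h (antiVec x ((1 : ℝ) * ω))
      rw [hf, vecDet_antiVec, norm_neg, norm_mul, norm_mul, hω, Complex.norm_real,
        Complex.norm_real, norm_one, Real.norm_eq_abs] at h1
      rcases le_total 0 x with hx | hx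
      · rw [abs_of_nonneg hx] at h1
        linarith
      · nlinarith [mul_nonneg ha (sq_nonneg x), mul_nonneg h0.le (neg_nonneg.2 hx)]
    have hd := discrim_le_zero hq
    rw [discrim] at hd
    have : (2 * r - c) / 2 ≤ √(a * b) := Real.le_sqrt_of_sq_le (by nlinarith)
    linarith

/-- The concurrence is the least constant bounding the negative part of the partial transpose. -/
theorem concurrence_le_of_forall (ρ : State) {c : ℝ} (hc : 0 ≤ c)
    (h : ∀ v, -ptForm ρ.mat v ≤ c * ‖vecDet v‖) : concurrence ρ ≤ c := by
  rcases le_or_gt (concurrence ρ) 0 with h0 | h0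
  · exact h0.trans hc
  · obtain ⟨U, hU, V, hV, hle⟩ := exists_concurrence_le_crossConcurrence ρ h0
    refine hle.trans (crossConcurrence_le (posSemidef_localFrame ρ.posSemidef U V) fun v => ?_)
    rw [ptForm_localFrame, ← norm_vecDet_mulVec hU (map_star_mem_unitaryGroup hV) v]
    exact h _

/-- The determinant of the block of $\rho^\Gamma+N/2$ on $|01\rangle,|10\rangle$ is nonnegative,
again read off from a discriminant. -/
theorem four_mul_sq_le_negativity (ρ : State) {U V : Matrix (Fin 2) (Fin 2) ℂ}
    (hU : U ∈ unitaryGroup (Fin 2) ℂ) (hV : V ∈ unitaryGroup (Fin 2) ℂ) :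
    4 * ‖localFrame U V ρ.mat (0, 0) (1, 1)‖ ^ 2 ≤
      (negativity ρ + 2 * (localFrame U V ρ.mat (0, 1) (0, 1)).re) *
        (negativity ρ + 2 * (localFrame U V ρ.mat (1, 0) (1, 0)).re) := by
  obtain ⟨ω, hω, hf⟩ :=
    exists_phase_ptForm_antiVec (posSemidef_localFrame ρ.posSemidef U V).isHermitian
  set B := localFrame U V ρ.mat with hB
  have hq : ∀ x : ℝ, 0 ≤ (negativity ρ + 2 * (B (0, 1) (0, 1)).re) * (x * x) +
      -(4 * ‖B (0, 0) (1, 1)‖) * x + (negativity ρ + 2 * (B (1, 0) (1, 0)).re) := fun x => by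
    have h1 := neg_ptForm_localFrame_le_negativity ρ hU hV (antiVec x ((1 : ℝ) * ω))
    rw [← hB, hf, vecNormSq_antiVec, norm_mul, hω, Complex.norm_real, Complex.norm_real,
      norm_one, Real.norm_eq_abs, sq_abs] at h1
    linarith
  have hd := discrim_le_zero hq
  rw [discrim] at hd
  linarith

theorem sq_norm_le_mul_re {B : Matrix Idx Idx ℂ} (hB : B.PosSemidef) (i j : Idx) :
    ‖B i j‖ ^ 2 ≤ (B i i).re * (B j j).re := by
  have h := hB.submatrix ![i, j]
  have hd := (Complex.le_def.1 h.det_nonneg).1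
  have hji : B j i = star (B i j) := (hB.isHermitian.apply _ _).symm
  have h1 : (B i i).im = 0 := by
    have := congrArg Complex.im (hB.isHermitian.apply i i)
    simp at this
    linarith
  have h3 : B i j * star (B i j) = ((‖B i j‖ ^ 2 : ℝ) : ℂ) := by
    simpa using Complex.mul_conj' (B i j)
  simp only [det_fin_two, submatrix_apply, cons_val_zero, cons_val_one, hji, h3] at hd
  simp only [Complex.zero_re, Complex.sub_re, Complex.mul_re, Complex.ofReal_re, h1] at hd
  linarith

theorem trace_localFrame {U V : Matrix (Fin 2) (Fin 2) ℂ} (hU : U ∈ unitaryGroup (Fin 2) ℂ)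
    (hV : V ∈ unitaryGroup (Fin 2) ℂ) (A : Matrix Idx Idx ℂ) :
    (localFrame U V A).trace = A.trace := by
  have h : (U ⊗ₖ V) * (U ⊗ₖ V)ᴴ = 1 := mem_unitaryGroup_iff.1 (kronecker_mem_unitary hU hV)
  rw [localFrame, trace_mul_comm, ← Matrix.mul_assoc, h, Matrix.one_mul]

theorem trace_localFrame_re (ρ : State) {U V : Matrix (Fin 2) (Fin 2) ℂ}
    (hU : U ∈ unitaryGroup (Fin 2) ℂ) (hV : V ∈ unitaryGroup (Fin 2) ℂ) :
    (localFrame U V ρ.mat (0, 0) (0, 0)).re + (localFrame U V ρ.mat (0, 1) (0, 1)).re +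
      (localFrame U V ρ.mat (1, 0) (1, 0)).re + (localFrame U V ρ.mat (1, 1) (1, 1)).re = 1 := by
  have h := congrArg Complex.re ((trace_localFrame hU hV ρ.mat).trans ρ.trace_eq_one)
  simp only [trace, diag_apply, Fintype.sum_prod_type, Fin.sum_univ_two, Complex.add_re,
    Complex.one_re] at h
  linarith

/-! ### Lower bound on the negativity -/

/-- The lower bound on the negativity, and the shape of the state in an optimal local frame when it
is attained. -/
theorem negativity_lower_bound_aux (ρ : State) (hC : 0 < concurrence ρ)
    {U V : Matrix (Fin 2) (Fin 2) ℂ} (hU : U ∈ unitaryGroup (Fin 2) ℂ)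
    (hV : V ∈ unitaryGroup (Fin 2) ℂ)
    (hle : concurrence ρ ≤ crossConcurrence (localFrame U V ρ.mat)) :
    concurrence ρ ≤ 1 ∧
    concurrence ρ ^ 2 ≤ negativity ρ ^ 2 + 2 * negativity ρ * (1 - concurrence ρ) ∧
    (negativity ρ ^ 2 + 2 * negativity ρ * (1 - concurrence ρ) = concurrence ρ ^ 2 →
      (localFrame U V ρ.mat (0, 1) (0, 1)).re * (localFrame U V ρ.mat (1, 0) (1, 0)).re = 0 ∧
      (localFrame U V ρ.mat (0, 1) (0, 1)).re + (localFrame U V ρ.mat (1, 0) (1, 0)).re =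
        1 - concurrence ρ ∧
      2 * ‖localFrame U V ρ.mat (0, 0) (1, 1)‖ = concurrence ρ ∧
      2 * (localFrame U V ρ.mat (0, 0) (0, 0)).re = concurrence ρ ∧
      2 * (localFrame U V ρ.mat (1, 1) (1, 1)).re = concurrence ρ) := by
  have hB := posSemidef_localFrame ρ.posSemidef U V
  have h4 := four_mul_sq_le_negativity ρ hU hV
  have htr := trace_localFrame_re ρ hU hV
  have hps := sq_norm_le_mul_re hB (0, 0) (1, 1)
  have ha := re_diag_nonneg hB (0, 1)
  have hb := re_diag_nonneg hB (1, 0)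
  have hp := re_diag_nonneg hB (0, 0)
  have hs := re_diag_nonneg hB (1, 1)
  have hr := norm_nonneg (localFrame U V ρ.mat (0, 0) (1, 1))
  rw [crossConcurrence] at hle
  have hN := negativity_nonneg ρ
  set a := (localFrame U V ρ.mat (0, 1) (0, 1)).re
  set b := (localFrame U V ρ.mat (1, 0) (1, 0)).re
  set p := (localFrame U V ρ.mat (0, 0) (0, 0)).re
  set s := (localFrame U V ρ.mat (1, 1) (1, 1)).re
  set r := ‖localFrame U V ρ.mat (0, 0) (1, 1)‖
  set N := negativity ρ
  set C := concurrence ρ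
  have hg := Real.sqrt_nonneg (a * b)
  have hgg := Real.mul_self_sqrt (mul_nonneg ha hb)
  set g := √(a * b)
  -- From $r^2\le ps$. With unit trace and $C+2g\le 2r$ it bounds $a+b$.
  have h2r : 2 * r ≤ p + s := by
    refine (sq_le_sq₀ (by linarith) (by linarith)).1 ?_
    nlinarith [sq_nonneg (p - s)]
  have hab : a + b ≤ 1 - C - 2 * g := by linarith
  -- The chain is $(C+2g)^2\le 4r^2\le N^2+2N(a+b)+4g^2\le N^2+2N(1-C-2g)+4g^2$. It exceeds the
  -- claim by $4Cg+4Ng\ge0$, so equality forces $g=0$ and then tightness in each link.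
  have hrC : (C + 2 * g) ^ 2 ≤ (2 * r) ^ 2 := pow_le_pow_left₀ (by linarith) (by linarith) 2
  have hNab : N * (a + b) ≤ N * (1 - C - 2 * g) := mul_le_mul_of_nonneg_left hab hN
  have hCg : 0 ≤ C * g := mul_nonneg hC.le hg
  have hNg : 0 ≤ N * g := mul_nonneg hN hg
  refine ⟨by linarith, by nlinarith, fun heq => ?_⟩
  have hg0 : g = 0 := by
    have : C * g = 0 := by nlinarith
    exact (mul_eq_zero.1 this).resolve_left hC.ne'
  rw [hg0] at hgg hab hrC hNab hle
  have hN0 : N ≠ 0 := fun h => by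
    rw [h] at heq
    nlinarith
  have hr2 : (2 * r) ^ 2 = C ^ 2 := by nlinarith
  have hrC' : 2 * r = C := by
    have := (sq_eq_sq₀ (by linarith) hC.le).1 hr2
    exact this
  have habC : a + b = 1 - C := by
    have : N * (a + b - (1 - C)) = 0 := by nlinarith
    linarith [(mul_eq_zero.1 this).resolve_left hN0]
  have hpsC : p + s = C := by linarith
  have hps' : p = s := by
    have : (p - s) ^ 2 ≤ 0 := by nlinarith
    nlinarith [pow_eq_zero_iff (two_ne_zero) |>.1 (le_antisymm this (sq_nonneg (p - s)))]
  exact ⟨by linarith, habC, hrC', by linarith, by linarith⟩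

/-! ### Quasi-distillable states -/

theorem inv_sqrt_two_mul_self : ((√2 : ℝ) : ℂ)⁻¹ * ((√2 : ℝ) : ℂ)⁻¹ = 1 / 2 := by
  rw [← mul_inv, ← Complex.ofReal_mul, Real.mul_self_sqrt zero_le_two]
  norm_num

theorem conj_inv_sqrt_two : star (((√2 : ℝ) : ℂ)⁻¹) = ((√2 : ℝ) : ℂ)⁻¹ := by
  simp

theorem proj_smul_inv_sqrt_two (u : Idx → ℂ) :
    proj (((√2 : ℝ) : ℂ)⁻¹ • u) = (1 / 2 : ℂ) • proj u := by
  ext a b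
  simp only [proj, vecMulVec_apply, Pi.smul_apply, Pi.star_apply, smul_eq_mul, star_mul',
    conj_inv_sqrt_two, Matrix.smul_apply]
  linear_combination (u a * star (u b)) * inv_sqrt_two_mul_self

theorem proj_bell_zero : proj (bell 0) = (1 / 2 : ℂ) • proj (ket 0 0 + ket 1 1) :=
  proj_smul_inv_sqrt_two _

theorem quasiDistillable_apply (c : ℝ) (a b : Idx) :
    quasiDistillable c a b =
      (c / 2 : ℂ) * ((ket 0 0 + ket 1 1) a * star ((ket 0 0 + ket 1 1) b)) +
        (1 - c : ℂ) * (ket 0 1 a * star (ket 0 1 b)) := by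
  rw [quasiDistillable, proj_bell_zero]
  simp only [Matrix.add_apply, Matrix.smul_apply, proj,
    vecMulVec_apply, Pi.star_apply, smul_eq_mul]
  push_cast
  ring

theorem ptForm_quasiDistillable (c : ℝ) (w : Idx → ℂ) :
    ptForm (quasiDistillable c) w = c / 2 * (‖w (0, 0)‖ ^ 2 + ‖w (1, 1)‖ ^ 2)
      + (1 - c) * ‖w (0, 1)‖ ^ 2 + c * (star (w (0, 1)) * w (1, 0)).re := by
  have h : star w ⬝ᵥ partialTranspose (quasiDistillable c) *ᵥ w =
      ((c / 2 : ℝ) : ℂ) * (w (0, 0) * star (w (0, 0)) + w (1, 1) * star (w (1, 1)))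
      + ((1 - c : ℝ) : ℂ) * (w (0, 1) * star (w (0, 1)))
      + ((c / 2 : ℝ) : ℂ) * (star (w (0, 1)) * w (1, 0) + star (star (w (0, 1)) * w (1, 0))) := by
    simp [partialTranspose, quasiDistillable_apply, mulVec, dotProduct, Fintype.sum_prod_type,
      Fin.sum_univ_two, ket, Pi.single_apply]
    ring
  have hn : ∀ z : ℂ, z * star z = ((‖z‖ ^ 2 : ℝ) : ℂ) := fun z => by
    simpa using Complex.mul_conj' z
  rw [ptForm, h, hn, hn, hn]
  simp only [Complex.add_re, Complex.re_ofReal_mul, Complex.ofReal_re, RCLike.star_def,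
    Complex.conj_re]
  ring

theorem localFrame_of_localUnitaryEquiv {A B U V} (hU : U ∈ unitaryGroup (Fin 2) ℂ)
    (hV : V ∈ unitaryGroup (Fin 2) ℂ) (h : A = (U ⊗ₖ V) * B * (U ⊗ₖ V)ᴴ) :
    localFrame U V A = B := by
  have h1 : (U ⊗ₖ V)ᴴ * (U ⊗ₖ V) = 1 := mem_unitaryGroup_iff'.1 (kronecker_mem_unitary hU hV)
  rw [localFrame, h]
  calc _ = (U ⊗ₖ V)ᴴ * (U ⊗ₖ V) * B * ((U ⊗ₖ V)ᴴ * (U ⊗ₖ V)) := by simp only [Matrix.mul_assoc]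
    _ = B := by rw [h1, Matrix.one_mul, Matrix.mul_one]

theorem eq_of_localFrame_eq {A B U V} (hU : U ∈ unitaryGroup (Fin 2) ℂ)
    (hV : V ∈ unitaryGroup (Fin 2) ℂ) (h : localFrame U V A = B) :
    A = (U ⊗ₖ V) * B * (U ⊗ₖ V)ᴴ := by
  have h1 : (U ⊗ₖ V) * (U ⊗ₖ V)ᴴ = 1 := mem_unitaryGroup_iff.1 (kronecker_mem_unitary hU hV)
  rw [← h, localFrame]
  calc A = (U ⊗ₖ V) * (U ⊗ₖ V)ᴴ * A * ((U ⊗ₖ V) * (U ⊗ₖ V)ᴴ) := by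
        rw [h1, Matrix.one_mul, Matrix.mul_one]
    _ = _ := by simp only [Matrix.mul_assoc]

theorem exists_localFrame_vec {U V : Matrix (Fin 2) (Fin 2) ℂ} (hU : U ∈ unitaryGroup (Fin 2) ℂ)
    (hV : V ∈ unitaryGroup (Fin 2) ℂ) (A : Matrix Idx Idx ℂ) (v : Idx → ℂ) :
    ∃ w, ptForm A v = ptForm (localFrame U V A) w ∧ vecNormSq w = vecNormSq v ∧
      ‖vecDet w‖ = ‖vecDet v‖ := by
  have hP := kronecker_mem_unitary hU (map_star_mem_unitaryGroup hV)
  set P := U ⊗ₖ V.map star with hPdef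
  have hv : P *ᵥ (Pᴴ *ᵥ v) = v := by
    rw [mulVec_mulVec, show P * Pᴴ = 1 from mem_unitaryGroup_iff.1 hP, one_mulVec]
  refine ⟨Pᴴ *ᵥ v, ?_, ?_, ?_⟩
  · rw [ptForm_localFrame, ← hPdef, hv]
  · conv_rhs => rw [← hv, vecNormSq_mulVec hP]
  · conv_rhs => rw [← hv, hPdef, norm_vecDet_mulVec hU (map_star_mem_unitaryGroup hV)]

theorem concurrence_of_quasiDistillable (ρ : State) {c : ℝ} (hc0 : 0 ≤ c) (hc1 : c ≤ 1)
    (h : LocalUnitaryEquiv ρ.mat (quasiDistillable c)) : concurrence ρ = c := by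
  obtain ⟨U, hU, V, hV, hρ⟩ := h
  have hfr := localFrame_of_localUnitaryEquiv hU hV hρ
  refine le_antisymm (concurrence_le_of_forall ρ hc0 fun v => ?_) ?_
  · obtain ⟨w, h1, -, h3⟩ := exists_localFrame_vec hU hV ρ.mat v
    rw [h1, ← h3, hfr, ptForm_quasiDistillable]
    have e1 : -(star (w (0, 1)) * w (1, 0)).re ≤ ‖w (0, 1)‖ * ‖w (1, 0)‖ := by
      have := (neg_le_abs _).trans (Complex.abs_re_le_norm (star (w (0, 1)) * w (1, 0)))
      rwa [norm_mul, norm_star] at this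
    have e2 : ‖w (0, 1)‖ * ‖w (1, 0)‖ - ‖w (0, 0)‖ * ‖w (1, 1)‖ ≤ ‖vecDet w‖ := by
      rw [vecDet, ← norm_mul, ← norm_mul, norm_sub_rev]
      exact norm_sub_norm_le _ _
    have e3 : -(star (w (0, 1)) * w (1, 0)).re - (‖w (0, 0)‖ ^ 2 + ‖w (1, 1)‖ ^ 2) / 2 ≤
        ‖vecDet w‖ := by nlinarith [sq_nonneg (‖w (0, 0)‖ - ‖w (1, 1)‖)]
    have e4 := mul_le_mul_of_nonneg_left e3 hc0
    have e5 := mul_nonneg (sub_nonneg.2 hc1) (sq_nonneg ‖w (0, 1)‖)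
    linarith
  · by_contra! hlt
    have hx : 0 < (c - concurrence ρ) / 2 := by linarith
    -- Testing with $x|01\rangle-|10\rangle$ gives $c-C\le(1-c)x$; for `x` equal to half the gap
    -- this reads $2x\le(1-c)x$, which is impossible.
    set x := (c - concurrence ρ) / 2 with hxdef
    have h1 := neg_ptForm_localFrame_le_concurrence ρ hU hV (antiVec x (-1))
    rw [hfr, ptForm_quasiDistillable, vecDet_antiVec] at h1
    simp only [antiVec, ofCoeff, of_apply, cons_val', cons_val_zero, cons_val_one,
      cons_val_fin_one, norm_zero, RCLike.star_def, Complex.conj_ofReal, mul_neg, mul_one,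
      Complex.neg_re, Complex.ofReal_re, Complex.norm_real, neg_neg,
      Real.norm_of_nonneg hx.le] at h1
    nlinarith [mul_nonneg hc0 hx.le, mul_pos hx hx, mul_nonneg hc0 (mul_pos hx hx).le]

theorem lower_bound_sq {N C : ℝ} (h : N = √((1 - C) ^ 2 + C ^ 2) - (1 - C)) :
    N ^ 2 + 2 * N * (1 - C) = C ^ 2 := by
  have := Real.sq_sqrt (show 0 ≤ (1 - C) ^ 2 + C ^ 2 by positivity)
  rw [show √((1 - C) ^ 2 + C ^ 2) = N + (1 - C) by linarith] at this
  linarith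

/-- The concurrence is at most one and the lower bound holds in polynomial form. -/
theorem negativity_lower_bound (ρ : State) : concurrence ρ ≤ 1 ∧
    concurrence ρ ^ 2 ≤ negativity ρ ^ 2 + 2 * negativity ρ * (1 - concurrence ρ) := by
  rcases (show 0 ≤ concurrence ρ from le_max_left _ _).eq_or_lt with h | h
  · rw [← h]
    have := negativity_nonneg ρ
    exact ⟨zero_le_one, by nlinarith [sq_nonneg (negativity ρ)]⟩
  · obtain ⟨U, hU, V, hV, hle⟩ := exists_concurrence_le_crossConcurrence ρ h
    have := negativity_lower_bound_aux ρ h hU hV hle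
    exact ⟨this.1, this.2.1⟩

theorem sqrt_sub_le_negativity (ρ : State) :
    √((1 - concurrence ρ) ^ 2 + concurrence ρ ^ 2) - (1 - concurrence ρ) ≤ negativity ρ := by
  obtain ⟨h1, h2⟩ := negativity_lower_bound ρ
  rw [sub_le_iff_le_add, Real.sqrt_le_left (by linarith [negativity_nonneg ρ])]
  linarith

theorem negativity_pos (ρ : State) (hC : 0 < concurrence ρ) : 0 < negativity ρ := by
  obtain ⟨h1, h2⟩ := negativity_lower_bound ρ
  refine (negativity_nonneg ρ).lt_of_ne fun h => ?_
  rw [← h] at h2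
  nlinarith

theorem negativity_of_quasiDistillable (ρ : State) (hC : 0 < concurrence ρ)
    (h : LocalUnitaryEquiv ρ.mat (quasiDistillable (concurrence ρ))) :
    negativity ρ = √((1 - concurrence ρ) ^ 2 + concurrence ρ ^ 2) - (1 - concurrence ρ) := by
  refine le_antisymm ?_ (sqrt_sub_le_negativity ρ)
  obtain ⟨hC1, -⟩ := negativity_lower_bound ρ
  obtain ⟨U, hU, V, hV, hρ⟩ := h
  have hfr := localFrame_of_localUnitaryEquiv hU hV hρ
  obtain ⟨μ, v, hμ, hv1, hv, hN⟩ := exists_negative_eigenvalue ρ (negativity_pos ρ hC)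
  have hn : vecNormSq v = 1 := by
    rw [star_dotProduct_self] at hv1
    exact_mod_cast hv1
  have hq := ptForm_of_eigenvector hv
  obtain ⟨w, h1, h2, -⟩ := exists_localFrame_vec hU hV ρ.mat v
  rw [hn] at h2 hq
  rw [h1, hfr, ptForm_quasiDistillable] at hq
  rw [vecNormSq_eq] at h2
  rw [abs_of_neg hμ] at hN
  set C := concurrence ρ
  set N₀ := √((1 - C) ^ 2 + C ^ 2) - (1 - C) with hN₀
  have e0 := lower_bound_sq hN₀
  have hN₀pos : 0 < N₀ := by
    rw [hN₀, sub_pos]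
    exact Real.lt_sqrt_of_sq_lt (by nlinarith)
  have e1 : -(star (w (0, 1)) * w (1, 0)).re ≤ ‖w (0, 1)‖ * ‖w (1, 0)‖ := by
    have := (neg_le_abs _).trans (Complex.abs_re_le_norm (star (w (0, 1)) * w (1, 0)))
    rwa [norm_mul, norm_star] at this
  set x := ‖w (0, 1)‖
  set y := ‖w (1, 0)‖
  -- The quadratic equation for `N₀` says exactly that this block form is degenerate, so up to a
  -- positive factor it is a perfect square.
  have e2 : 0 ≤ (1 - C + N₀ / 2) * x ^ 2 - C * (x * y) + N₀ / 2 * y ^ 2 := by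
    have : N₀ * (2 * ((1 - C + N₀ / 2) * x ^ 2 - C * (x * y) + N₀ / 2 * y ^ 2)) =
        (C * x - N₀ * y) ^ 2 := by linear_combination x ^ 2 * e0
    have h3 : 0 ≤ N₀ * (2 * ((1 - C + N₀ / 2) * x ^ 2 - C * (x * y) + N₀ / 2 * y ^ 2)) := by
      rw [this]; positivity
    linarith [nonneg_of_mul_nonneg_right h3 hN₀pos]
  have e3 := mul_le_mul_of_nonneg_left e1 hC.le
  have e4 : 0 ≤ (C / 2 + N₀ / 2) * (‖w (0, 0)‖ ^ 2 + ‖w (1, 1)‖ ^ 2) := by positivity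
  have e5 : N₀ / 2 * (‖w (0, 0)‖ ^ 2 + x ^ 2 + y ^ 2 + ‖w (1, 1)‖ ^ 2) = N₀ / 2 := by
    rw [h2, mul_one]
  linarith

/-- The upper estimate is a factorization through dimension two; the lower one is the invertible
principal submatrix at $|00\rangle,|01\rangle$. -/
theorem rank_quasiDistillable {c : ℝ} (h0 : 0 < c) (h1 : c < 1) :
    (quasiDistillable c).rank = 2 := by
  apply le_antisymm
  · set F : Matrix Idx (Fin 2) ℂ :=
      of fun a => ![(c : ℂ) * bell 0 a, ((1 - c : ℝ) : ℂ) * ket 0 1 a] with hF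
    set G : Matrix (Fin 2) Idx ℂ := of ![star (bell 0), star (ket 0 1)] with hG
    have h : quasiDistillable c = F * G := by
      ext a b
      simp [hF, hG, Matrix.mul_apply, Fin.sum_univ_two, quasiDistillable, proj, vecMulVec_apply,
        mul_assoc]
    rw [h]
    exact (rank_mul_le_left F G).trans ((rank_le_card_width F).trans (by simp))
  · set f : Fin 2 → Idx := ![(0, 0), (0, 1)]
    have hsub : (quasiDistillable c).submatrix f f = diagonal ![(c / 2 : ℂ), 1 - c] := by
      ext i j
      fin_cases i <;> fin_cases j <;> simp [f, quasiDistillable_apply, ket]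
    have hu : IsUnit ((quasiDistillable c).submatrix f f) := by
      rw [hsub, isUnit_iff_isUnit_det, det_diagonal, Fin.prod_univ_two, isUnit_iff_ne_zero]
      have hc : (c : ℂ) ≠ 0 := by exact_mod_cast h0.ne'
      have hc1 : (1 - c : ℂ) ≠ 0 := by
        rw [sub_ne_zero]
        exact_mod_cast h1.ne'
      simp [hc, hc1]
    have := rank_of_isUnit _ hu
    rw [Fintype.card_fin] at this
    exact this.symm.trans_le (rank_submatrix_le _ _ _)

/-! ### Equality in the lower bound -/

/-- In an optimal local frame with vanishing weight of `|10⟩`, a state attaining the lower bound is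
quasi-distillable. -/
theorem localUnitaryEquiv_of_frame (ρ : State) (hC : 0 < concurrence ρ)
    {U V : Matrix (Fin 2) (Fin 2) ℂ} (hU : U ∈ unitaryGroup (Fin 2) ℂ)
    (hV : V ∈ unitaryGroup (Fin 2) ℂ)
    (heq : negativity ρ ^ 2 + 2 * negativity ρ * (1 - concurrence ρ) = concurrence ρ ^ 2)
    (hb : (localFrame U V ρ.mat (1, 0) (1, 0)).re = 0)
    (ha : (localFrame U V ρ.mat (0, 1) (0, 1)).re = 1 - concurrence ρ)
    (hr : 2 * ‖localFrame U V ρ.mat (0, 0) (1, 1)‖ = concurrence ρ)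
    (hp : 2 * (localFrame U V ρ.mat (0, 0) (0, 0)).re = concurrence ρ)
    (hs : 2 * (localFrame U V ρ.mat (1, 1) (1, 1)).re = concurrence ρ) :
    LocalUnitaryEquiv ρ.mat (quasiDistillable (concurrence ρ)) := by
  have hB := posSemidef_localFrame ρ.posSemidef U V
  have hN := negativity_pos ρ hC
  have hC1 := (negativity_lower_bound ρ).1
  obtain ⟨ω, hω, hf⟩ := exists_phase_ptForm_antiVec hB.isHermitian
  have hform := fun w => ptForm_localFrame U V ρ.mat w
  have hpt := partialTranspose_localFrame U V ρ.mat
  set B := localFrame U V ρ.mat with hBdef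
  set N := negativity ρ with hNdef
  set C := concurrence ρ
  have hP := kronecker_mem_unitary hU (map_star_mem_unitaryGroup hV)
  set P := U ⊗ₖ V.map star with hPdef
  -- With this ratio, `w` is the null vector of the block of $\rho^\Gamma+N/2$, which is singular by
  -- `heq`. It minimizes the whole form and is thus an eigenvector of the full partial transpose.
  set y : ℝ := N + 2 * (1 - C) with hy
  set w := antiVec C (y * ω) with hw
  have hwf : ptForm B w = -(N / 2) * vecNormSq w := by
    rw [hw, hf, vecNormSq_antiVec, norm_mul, hω, Complex.norm_real, Complex.norm_real,
      Real.norm_eq_abs, Real.norm_eq_abs, mul_one, sq_abs, sq_abs, hb, ha]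
    have : ‖B (0, 0) (1, 1)‖ = C / 2 := by linarith
    rw [this, hy]
    linear_combination ((N + 2 * (1 - C)) / 2) * heq
  have hev : partialTranspose B *ᵥ w = ((-(N / 2) : ℝ) : ℂ) • w := by
    have h1 : ptForm ρ.mat (P *ᵥ w) = -(negativity ρ / 2) * vecNormSq (P *ᵥ w) := by
      rw [← hform, hwf, vecNormSq_mulVec hP]
    have h2 := partialTranspose_mulVec_of_ptForm_eq ρ h1
    rw [hpt, ← mulVec_mulVec, ← mulVec_mulVec, h2, mulVec_smul, mulVec_mulVec,
      show Pᴴ * P = 1 from mem_unitaryGroup_iff'.1 hP, one_mulVec]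
  have hz : ∀ i, B i (1, 0) = 0 ∧ B (1, 0) i = 0 := fun i => by
    have h1 := sq_norm_le_mul_re hB i (1, 0)
    have h2 := sq_norm_le_mul_re hB (1, 0) i
    rw [hb, mul_zero] at h1
    rw [hb, zero_mul] at h2
    exact ⟨by simpa using le_antisymm h1 (sq_nonneg _), by simpa using le_antisymm h2 (sq_nonneg _)⟩
  have hC0 : (C : ℂ) ≠ 0 := by exact_mod_cast hC.ne'
  -- `w` has no component at $|00\rangle$ or $|11\rangle$, so these rows of the eigenvalue equation,
  -- in which the entries involving $|10\rangle$ already vanish, kill the remaining coherences.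
  have z1 : B (0, 1) (0, 0) = 0 := by
    have := congrFun hev (0, 0)
    simp [mulVec, dotProduct, Fintype.sum_prod_type, Fin.sum_univ_two, partialTranspose, hw,
      antiVec, ofCoeff, (hz _).1] at this
    exact this.resolve_right hC.ne'
  have z2 : B (1, 1) (0, 1) = 0 := by
    have := congrFun hev (1, 1)
    simp [mulVec, dotProduct, Fintype.sum_prod_type, Fin.sum_univ_two, partialTranspose, hw,
      antiVec, ofCoeff, (hz _).2] at this
    exact this.resolve_right hC.ne'
  have z1' : B (0, 0) (0, 1) = 0 := by rw [← hB.isHermitian.apply, z1, star_zero]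
  have z2' : B (0, 1) (1, 1) = 0 := by rw [← hB.isHermitian.apply, z2, star_zero]
  have hre : ∀ i, B i i = ((B i i).re : ℂ) := fun i => by
    have := congrArg Complex.im (hB.isHermitian.apply i i)
    simp at this
    apply Complex.ext <;> simp
    linarith
  have d00 : B (0, 0) (0, 0) = (C / 2 : ℂ) := by
    rw [hre, ← hp]; push_cast; ring
  have d11 : B (1, 1) (1, 1) = (C / 2 : ℂ) := by
    rw [hre, ← hs]; push_cast; ring
  have d01 : B (0, 1) (0, 1) = (1 - C : ℂ) := by
    rw [hre, ha]; push_cast; ring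
  obtain ⟨η, hη, hηB⟩ : ∃ η : ℂ, ‖η‖ = 1 ∧ B (0, 0) (1, 1) = (C / 2 : ℂ) * η := by
    refine ⟨B (0, 0) (1, 1) / (C / 2 : ℂ), ?_, ?_⟩
    · have h2 : ‖(C / 2 : ℂ)‖ = C / 2 := by
        rw [norm_div, Complex.norm_real, Real.norm_of_nonneg hC.le]
        simp
      rw [norm_div, h2, div_eq_one_iff_eq (by linarith)]
      linarith
    · field_simp
  have d10 : B (1, 1) (0, 0) = (C / 2 : ℂ) * star η := by
    rw [← hB.isHermitian.apply, hηB]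
    simp [mul_comm]
  have hηη : star η * η = 1 := by
    have := Complex.mul_conj' η
    rw [hη] at this
    rw [mul_comm]
    simpa using this
  -- A phase on the first qubit absorbs the argument of the only surviving coherence.
  set D : Matrix (Fin 2) (Fin 2) ℂ := diagonal ![1, star η] with hD
  have hDu : D ∈ unitaryGroup (Fin 2) ℂ := by
    rw [mem_unitaryGroup_iff, star_eq_conjTranspose, hD, diagonal_conjTranspose,
      diagonal_mul_diagonal, ← diagonal_one]
    congr 1; ext i
    fin_cases i
    · simp
    · simpa using hηη
  have hBq : B = (D ⊗ₖ (1 : Matrix (Fin 2) (Fin 2) ℂ)) * quasiDistillable C *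
      (D ⊗ₖ (1 : Matrix (Fin 2) (Fin 2) ℂ))ᴴ := by
    have hdiag : D ⊗ₖ (1 : Matrix (Fin 2) (Fin 2) ℂ) =
        diagonal fun a : Idx => (![1, star η] : Fin 2 → ℂ) a.1 := by
      rw [hD, ← diagonal_one, diagonal_kronecker_diagonal]
      simp
    rw [hdiag, diagonal_conjTranspose]
    ext ⟨i, j⟩ ⟨k, l⟩
    rw [mul_diagonal, diagonal_mul, quasiDistillable_apply]
    fin_cases i <;> fin_cases j <;> fin_cases k <;> fin_cases l <;>
      simp [ket, z1, z1', z2, z2', d00, d11, d01, d10, hηB, (hz _).1, (hz _).2]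
    · ring
    · rw [← RCLike.star_def]
      linear_combination (-(C / 2 : ℂ)) * hηη
  refine ⟨U * D, mul_mem hU hDu, V, hV, ?_⟩
  rw [eq_of_localFrame_eq hU hV (hBdef.symm.trans hBq)]
  have : (U * D) ⊗ₖ V = (U ⊗ₖ V) * (D ⊗ₖ (1 : Matrix (Fin 2) (Fin 2) ℂ)) := by
    rw [← mul_kronecker_mul, Matrix.mul_one]
  rw [this, conjTranspose_mul]
  simp only [Matrix.mul_assoc]

theorem submatrix_equiv_mem_unitaryGroup {n : Type*} [Fintype n] [DecidableEq n] {U : Matrix n n ℂ}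
    (hU : U ∈ unitaryGroup n ℂ) (σ : Equiv.Perm n) : U.submatrix id σ ∈ unitaryGroup n ℂ := by
  rw [mem_unitaryGroup_iff'] at hU ⊢
  have : star (U.submatrix id σ) * U.submatrix id σ = (star U * U).submatrix σ σ := rfl
  rw [this, hU, submatrix_one_equiv]

theorem localFrame_submatrix (U V : Matrix (Fin 2) (Fin 2) ℂ) (σ : Equiv.Perm (Fin 2))
    (A : Matrix Idx Idx ℂ) :
    localFrame (U.submatrix id σ) (V.submatrix id σ) A =
      (localFrame U V A).submatrix (Prod.map σ σ) (Prod.map σ σ) := rfl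

/-- A state attaining the lower bound is quasi-distillable. -/
theorem localUnitaryEquiv_of_eq (ρ : State) (hC : 0 < concurrence ρ)
    (heq : negativity ρ ^ 2 + 2 * negativity ρ * (1 - concurrence ρ) = concurrence ρ ^ 2) :
    LocalUnitaryEquiv ρ.mat (quasiDistillable (concurrence ρ)) := by
  obtain ⟨U, hU, V, hV, hle⟩ := exists_concurrence_le_crossConcurrence ρ hC
  obtain ⟨h1, h2, h3, h4, h5⟩ := (negativity_lower_bound_aux ρ hC hU hV hle).2.2 heq
  rcases mul_eq_zero.1 h1 with ha | hb
  -- If the weight of $|01\rangle$ is the one that vanishes, flipping both qubits exchanges it with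
  -- that of $|10\rangle$.
  · have e : localFrame (U.submatrix id (Equiv.swap 0 1)) (V.submatrix id (Equiv.swap 0 1)) ρ.mat =
      (localFrame U V ρ.mat).submatrix (Prod.map (Equiv.swap 0 1) (Equiv.swap 0 1))
        (Prod.map (Equiv.swap 0 1) (Equiv.swap 0 1)) := localFrame_submatrix _ _ _ _
    refine localUnitaryEquiv_of_frame ρ hC (submatrix_equiv_mem_unitaryGroup hU (Equiv.swap 0 1))
      (submatrix_equiv_mem_unitaryGroup hV (Equiv.swap 0 1)) heq ?_ ?_ ?_ ?_ ?_ <;>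
      simp only [e, submatrix_apply, Prod.map_apply, Equiv.swap_apply_left, Equiv.swap_apply_right]
    · exact ha
    · linarith
    · rw [← h3, ← (posSemidef_localFrame ρ.posSemidef U V).isHermitian.apply, norm_star]
    · exact h5
    · exact h4
  · exact localUnitaryEquiv_of_frame ρ hC hU hV heq hb (by linarith) h3 h4 h5

/-! ### Equality in the upper bound -/

theorem coeffMatrix_bell_zero :
    coeffMatrix (bell 0) = ((√2 : ℝ) : ℂ)⁻¹ • (1 : Matrix (Fin 2) (Fin 2) ℂ) := by
  ext i j
  fin_cases i <;> fin_cases j <;> simp [coeffMatrix, bell, ket]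

/-- A maximally entangled unit vector is a Bell state up to local unitaries. -/
theorem isBellUpToLocalUnitary_of_le {v : Idx → ℂ} (hv : vecNormSq v = 1)
    (hd : 1 / 2 ≤ ‖vecDet v‖) : IsBellUpToLocalUnitary v := by
  have hd' : ‖vecDet v‖ = 1 / 2 := le_antisymm (by rw [← hv]; exact norm_vecDet_le v) hd
  set a := v (0, 0) with ha
  set b := v (0, 1) with hb
  set c := v (1, 0) with hc
  set d := v (1, 1) with hdd
  rw [vecNormSq_eq, ← ha, ← hb, ← hc, ← hdd] at hv
  have hD : vecDet v = a * d - b * c := rfl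
  set u := 2 * vecDet v with hu
  have hu1 : ‖u‖ = 1 := by rw [hu, norm_mul, hd']; norm_num
  have hn : ∀ z : ℂ, ((‖z‖ ^ 2 : ℝ) : ℂ) = z * star z := fun z => by
    simpa using (Complex.mul_conj' z).symm
  have huu : u * star u = 1 := by rw [← hn, hu1]; norm_num
  have hvc : a * star a + b * star b + c * star c + d * star d = 1 := by
    rw [← hn, ← hn, ← hn, ← hn]
    exact_mod_cast hv
  have h2 : star u * (a * d - b * c) = 1 / 2 := by
    rw [← hD]
    linear_combination (1 / 2) * huu
  have h3 : u * (star a * star d - star b * star c) = 1 / 2 := by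
    have := congrArg star h2
    simp only [star_mul', star_sub, star_star] at this
    rw [this]
    simp
  -- Expanded, this is $\|v\|^2-2|\det v|=0$. Its vanishing expresses the first row of the
  -- coefficient matrix through the second and makes $\sqrt2$ times that matrix unitary.
  have hsum : ‖a - u * star d‖ ^ 2 + ‖b + u * star c‖ ^ 2 = 0 := by
    have : ((‖a - u * star d‖ ^ 2 : ℝ) : ℂ) + ((‖b + u * star c‖ ^ 2 : ℝ) : ℂ) = 0 := by
      rw [hn, hn]
      simp only [star_sub, star_add, star_mul', star_star]
      linear_combination hvc - h2 - h3 + (d * star d + c * star c) * huu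
    exact_mod_cast this
  have e1 : a = u * star d := by
    have h := (add_eq_zero_iff_of_nonneg (sq_nonneg _) (sq_nonneg _)).1 hsum
    exact sub_eq_zero.1 (by simpa using h.1)
  have e2 : b = -(u * star c) := by
    have h := (add_eq_zero_iff_of_nonneg (sq_nonneg _) (sq_nonneg _)).1 hsum
    exact eq_neg_of_add_eq_zero_left (by simpa using h.2)
  have e3 : c * star c + d * star d = 1 / 2 := by
    rw [e1, e2] at hvc
    simp only [star_neg, star_mul', star_star] at hvc
    linear_combination (1 / 2) * hvc - (1 / 2) * (c * star c + d * star d) * huu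
  have hs2 : ((√2 : ℝ) : ℂ) * ((√2 : ℝ) : ℂ) = 2 := by
    rw [← Complex.ofReal_mul, Real.mul_self_sqrt zero_le_two]
    norm_num
  have hs0 : ((√2 : ℝ) : ℂ) ≠ 0 := fun h => by simp [h] at hs2
  have hss : star ((√2 : ℝ) : ℂ) = ((√2 : ℝ) : ℂ) := Complex.conj_ofReal _
  have hAA : coeffMatrix v * (coeffMatrix v)ᴴ = (1 / 2 : ℂ) • 1 := by
    ext i j
    fin_cases i <;> fin_cases j <;>
      simp only [coeffMatrix, Matrix.mul_apply, Fin.sum_univ_two, of_apply, conjTranspose_apply,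
        Fin.zero_eta, Fin.mk_one, ← ha, ← hb, ← hc, ← hdd, e1, e2, Matrix.smul_apply, one_apply_eq,
        ne_eq, zero_ne_one, one_ne_zero, not_false_eq_true, one_apply_ne, smul_eq_mul, mul_one,
        mul_zero, star_neg, star_mul', star_star]
    · linear_combination e3 + (c * star c + d * star d) * huu
    · ring
    · ring
    · linear_combination e3
  refine ⟨((√2 : ℝ) : ℂ) • coeffMatrix v, ?_, 1, one_mem _, 0, ?_⟩
  · rw [mem_unitaryGroup_iff, star_smul, star_eq_conjTranspose, Matrix.smul_mul, Matrix.mul_smul,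
      smul_smul, hAA, hss, hs2, smul_smul]
    norm_num
  · have h : coeffMatrix ((((√2 : ℝ) : ℂ) • coeffMatrix v) ⊗ₖ (1 : Matrix (Fin 2) (Fin 2) ℂ) *ᵥ
        bell 0) = coeffMatrix v := by
      rw [coeffMatrix_kronecker_mulVec, coeffMatrix_bell_zero, transpose_one, Matrix.mul_one,
        Matrix.mul_smul, Matrix.mul_one, smul_smul, inv_mul_cancel₀ hs0, one_smul]
    exact (congrArg ofCoeff h).symm

theorem coeffMatrix_bell_mul_conjTranspose (k : Fin 4) :
    coeffMatrix (bell k) * (coeffMatrix (bell k))ᴴ =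
      (1 / 2 : ℂ) • (1 : Matrix (Fin 2) (Fin 2) ℂ) := by
  have key : ∀ u : Idx → ℂ, coeffMatrix u * (coeffMatrix u)ᴴ = 1 →
      coeffMatrix (((√2 : ℝ) : ℂ)⁻¹ • u) * (coeffMatrix (((√2 : ℝ) : ℂ)⁻¹ • u))ᴴ =
        (1 / 2 : ℂ) • (1 : Matrix (Fin 2) (Fin 2) ℂ) := fun u hu => by
    have : coeffMatrix (((√2 : ℝ) : ℂ)⁻¹ • u) = ((√2 : ℝ) : ℂ)⁻¹ • coeffMatrix u := rfl
    rw [this, conjTranspose_smul, Matrix.smul_mul, Matrix.mul_smul, smul_smul, conj_inv_sqrt_two,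
      inv_sqrt_two_mul_self, hu]
  fin_cases k <;> refine key _ ?_ <;> ext i j <;> fin_cases i <;> fin_cases j <;>
    simp [coeffMatrix, ket, Matrix.mul_apply, Fin.sum_univ_two]

theorem two_smul_coeffMatrix_mul_conjTranspose {v : Idx → ℂ} (hv : IsBellUpToLocalUnitary v) :
    coeffMatrix v * ((2 : ℂ) • (coeffMatrix v)ᴴ) = 1 := by
  obtain ⟨U, hU, V, hV, k, rfl⟩ := hv
  have hV' : Vᵀ * Vᵀᴴ = 1 := by
    have := congrArg transpose (mem_unitaryGroup_iff'.1 hV)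
    rw [transpose_mul, transpose_one] at this
    exact this
  rw [coeffMatrix_kronecker_mulVec, conjTranspose_mul, conjTranspose_mul, Matrix.mul_smul]
  calc (2 : ℂ) • (U * coeffMatrix (bell k) * Vᵀ * (Vᵀᴴ * ((coeffMatrix (bell k))ᴴ * Uᴴ)))
      = (2 : ℂ) • (U * (coeffMatrix (bell k) * (Vᵀ * Vᵀᴴ) * (coeffMatrix (bell k))ᴴ) * Uᴴ) := by
        simp only [Matrix.mul_assoc]
    _ = 1 := by
        rw [hV', Matrix.mul_one, coeffMatrix_bell_mul_conjTranspose, Matrix.mul_smul,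
          Matrix.smul_mul, Matrix.mul_one, show U * Uᴴ = 1 from mem_unitaryGroup_iff.1 hU,
          smul_smul]
        norm_num

/-- If the eigenvector for the negative eigenvalue of the partial transpose is a Bell state up to
local unitaries, the negativity is at least the concurrence. -/
theorem concurrence_le_of_isBell (ρ : State) {μ : ℝ} {v : Idx → ℂ} (hμ : μ < 0)
    (hv1 : star v ⬝ᵥ v = 1) (hv : partialTranspose ρ.mat *ᵥ v = (μ : ℂ) • v)
    (hbell : IsBellUpToLocalUnitary v) : concurrence ρ ≤ 2 * |μ| := by
  have hA := two_smul_coeffMatrix_mul_conjTranspose hbell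
  have hn : vecNormSq v = 1 := by
    rw [star_dotProduct_self] at hv1
    exact_mod_cast hv1
  have hH := ρ.posSemidef.isHermitian
  have hdet : ‖vecDet v‖ = 1 / 2 := by
    have h := congrArg (fun M => ‖M.det‖) hA
    simp only [det_mul, det_smul, det_conjTranspose, det_one, norm_mul, norm_pow, norm_star,
      norm_one, det_coeffMatrix, Fintype.card_fin, Complex.norm_ofNat] at h
    nlinarith [norm_nonneg (vecDet v)]
  -- Since $2A^\dagger$ inverts the coefficient matrix $A$ of `v`, Hilbert-space orthogonality to
  -- `v` implies orthogonality for the polarized determinant, and $\det$ splits along $v\oplus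
  -- v^\perp$.
  have hpolar : ∀ w, star v ⬝ᵥ w = 0 → polarDet (coeffMatrix v) (coeffMatrix w) = 0 := by
    intro w hw
    have h1 : coeffMatrix w = coeffMatrix v * ((2 : ℂ) • (coeffMatrix v)ᴴ * coeffMatrix w) := by
      rw [← Matrix.mul_assoc, hA, Matrix.one_mul]
    have h2 : ((coeffMatrix v)ᴴ * coeffMatrix w).trace = star v ⬝ᵥ w := by
      simp [trace_fin_two, Matrix.mul_apply, Fin.sum_univ_two, coeffMatrix, dotProduct,
        Fintype.sum_prod_type]
      ring
    rw [h1, ← Matrix.mul_one (coeffMatrix v), Matrix.mul_assoc, Matrix.one_mul, polarDet_mul,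
      polarDet_one, Matrix.mul_one, Matrix.smul_mul, trace_smul, h2, hw]
    simp
  have hdetadd : ∀ (α : ℂ) (w : Idx → ℂ), star v ⬝ᵥ w = 0 →
      vecDet (α • v + w) = α ^ 2 * vecDet v + vecDet w := fun α w hw => by
    have h1 : polarDet (coeffMatrix (α • v)) (coeffMatrix w) =
        α * polarDet (coeffMatrix v) (coeffMatrix w) := by
      simp [polarDet, coeffMatrix]
      ring
    rw [vecDet_add, h1, hpolar w hw, vecDet_smul, mul_zero, add_zero]
  have hperp : ∀ w, star v ⬝ᵥ w = 0 → 2 * |μ| * ‖vecDet w‖ ≤ ptForm ρ.mat w := fun w hw => by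
    have hd0 : vecDet v ≠ 0 := fun h => by
      rw [h, norm_zero] at hdet
      norm_num at hdet
    -- This `α` makes $\alpha v+w$ a product vector; nonnegativity of the form there bounds it from
    -- below at `w`, with $|\alpha|^2=2|\det w|$.
    obtain ⟨α, hα⟩ := IsAlgClosed.exists_pow_nat_eq (-(vecDet w / vecDet v)) (n := 2) two_pos
    have h1 := neg_ptForm_le_concurrence ρ (α • v + w)
    rw [hdetadd α w hw, hα, neg_mul, div_mul_cancel₀ _ hd0, neg_add_cancel, norm_zero, mul_zero,
      ptForm_add_of_eigenvector hH hv hw, hn] at h1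
    have h2 := congrArg (‖·‖) hα
    simp only [norm_pow, norm_neg, norm_div, hdet] at h2
    rw [h2] at h1
    rw [abs_of_neg hμ]
    linarith
  refine concurrence_le_of_forall ρ (by positivity) fun ψ => ?_
  set α := star v ⬝ᵥ ψ with hα
  set w := ψ - α • v with hw
  have hvw : star v ⬝ᵥ w = 0 := by
    rw [hw, dotProduct_sub, dotProduct_smul, hv1, ← hα, smul_eq_mul, mul_one, sub_self]
  have hψ : ψ = α • v + w := by rw [hw]; abel
  rw [hψ, ptForm_add_of_eigenvector hH hv hvw, hdetadd α w hvw, hn]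
  have h1 := hperp w hvw
  have h2 : ‖α‖ ^ 2 / 2 - ‖vecDet w‖ ≤ ‖α ^ 2 * vecDet v + vecDet w‖ := by
    have := norm_sub_norm_le (α ^ 2 * vecDet v) (-vecDet w)
    rw [norm_neg, sub_neg_eq_add, norm_mul, norm_pow, hdet] at this
    linarith
  have h3 := mul_le_mul_of_nonneg_left h2 (abs_nonneg μ)
  have h4 : |μ| = -μ := abs_of_neg hμ
  rw [h4] at h1 h3 ⊢
  linarith

theorem negativity_eq_concurrence_iff (ρ : State) {μ : ℝ} {v : Idx → ℂ} (hC : 0 < concurrence ρ)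
    (hμ : μ < 0) (hv1 : star v ⬝ᵥ v = 1) (hv : partialTranspose ρ.mat *ᵥ v = (μ : ℂ) • v)
    (hN : negativity ρ = 2 * |μ|) :
    negativity ρ = concurrence ρ ↔ IsBellUpToLocalUnitary v := by
  constructor
  · intro h
    have hn : vecNormSq v = 1 := by
      rw [star_dotProduct_self] at hv1
      exact_mod_cast hv1
    have h1 := neg_ptForm_le_concurrence ρ v
    rw [ptForm_of_eigenvector hv, hn] at h1
    refine isBellUpToLocalUnitary_of_le hn ?_
    rw [abs_of_neg hμ] at hN
    by_contra! hlt
    nlinarith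
  · intro h
    exact le_antisymm (negativity_le_concurrence ρ)
      (hN ▸ concurrence_le_of_isBell ρ hμ hv1 hv h)

/-! ### Pure states -/

/-- Pure states have equal negativity and concurrence. -/
theorem negativity_eq_concurrence_of_isPure (ρ : State) (h : ρ.IsPure) :
    negativity ρ = concurrence ρ := by
  obtain ⟨z, hz⟩ := h
  refine le_antisymm (negativity_le_concurrence ρ) ?_
  have hC : concurrence ρ ≤ 2 * ‖vecDet z‖ := concurrence_le_of_forall ρ (by positivity) fun v => by
    rw [hz]
    exact neg_ptForm_proj_le z v
  refine hC.trans ?_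
  by_cases h0 : vecDet z = 0
  · rw [h0, norm_zero, mul_zero]
    exact negativity_nonneg ρ
  have hZ : IsUnit (coeffMatrix z) := by
    rw [isUnit_iff_isUnit_det, det_coeffMatrix]
    exact isUnit_iff_ne_zero.2 h0
  obtain ⟨R, hR, S, hS, d, hd, hZd⟩ := exists_svd hZ
  have hRR : Rᴴ * R = 1 := mem_unitaryGroup_iff'.1 hR
  have hSS : Sᴴ * S = 1 := mem_unitaryGroup_iff'.1 hS
  have hSS' : S * Sᴴ = 1 := mem_unitaryGroup_iff.1 hS
  set J : Matrix (Fin 2) (Fin 2) ℂ := !![0, -1; 1, 0] with hJ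
  have hnorm : ‖vecDet z‖ = d 0 * d 1 := by
    rw [← det_coeffMatrix, hZd, det_mul, det_mul, det_diagonal, norm_mul, norm_mul,
      norm_det_of_mem_unitaryGroup hR, norm_det_of_mem_unitaryGroup hS, Fin.prod_univ_two,
      norm_mul, Complex.norm_real, Complex.norm_real, Real.norm_of_nonneg (hd 0).le,
      Real.norm_of_nonneg (hd 1).le]
    ring
  have hJu : J ∈ unitaryGroup (Fin 2) ℂ := by
    rw [mem_unitaryGroup_iff, star_eq_conjTranspose]
    ext i j
    fin_cases i <;> fin_cases j <;> simp [hJ, Matrix.mul_apply, Fin.sum_univ_two]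
  have hSHu : IsUnit (Sᴴ).det :=
    IsUnit.of_mul_eq_one _ (by rw [← det_mul, hSS, det_one])
  have hSinv : (Sᴴ)⁻¹ = S := inv_eq_left_inv hSS'
  -- The analogue of the optimal vector built from the singular vectors of `z`. Here `Q` is unitary,
  -- so the test vector is maximally entangled and the negativity sees the full value $2d_0d_1$.
  set Q := (Sᴴ).map star * J * Rᴴ with hQ
  have hQu : Q ∈ unitaryGroup (Fin 2) ℂ :=
    mul_mem (mul_mem (map_star_mem_unitaryGroup (Unitary.star_mem hS)) hJu) (Unitary.star_mem hR)
  have hform : ptForm (proj z) (ofCoeff Qᴴ) = -2 * (d 0 * d 1) := by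
    rw [ptForm_proj, coeffMatrix_ofCoeff, conjTranspose_conjTranspose]
    have : Q * coeffMatrix z =
        (Sᴴ).map star * (J * diagonal fun i => (d i : ℂ)) * (Sᴴ)⁻¹ := by
      rw [hQ, hZd, hSinv]
      calc _ = (Sᴴ).map star * (J * ((Rᴴ * R) * diagonal fun i => (d i : ℂ))) * S := by
            simp only [Matrix.mul_assoc]
        _ = _ := by rw [hRR, Matrix.one_mul]
    rw [this, trace_conj_mul_map_star _ _ hSHu, trace_mul_map_star_re]
    simp [hJ]
    ring
  have hn : vecNormSq (ofCoeff Qᴴ) = 2 := by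
    have h1 : star (ofCoeff Qᴴ) ⬝ᵥ ofCoeff Qᴴ = (Q * Qᴴ).trace := by
      simp [trace_fin_two, Matrix.mul_apply, Fin.sum_univ_two, ofCoeff, dotProduct,
        Fintype.sum_prod_type]
      ring
    rw [show Q * Qᴴ = 1 from mem_unitaryGroup_iff.1 hQu, star_dotProduct_self] at h1
    apply Complex.ofReal_injective
    rw [h1]
    simp
  have := neg_ptForm_le_negativity ρ (ofCoeff Qᴴ)
  rw [hz, hform, hn] at this
  rw [hnorm]
  linarith

/-! ### Bell-diagonal states -/

theorem ptForm_proj_smul_inv_sqrt_two (u w : Idx → ℂ) :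
    ptForm (proj (((√2 : ℝ) : ℂ)⁻¹ • u)) w = 1 / 2 * ptForm (proj u) w := by
  rw [proj_smul_inv_sqrt_two, ← ptForm_smul]
  norm_num

/-- The partial transpose of a Bell projection is $\tfrac12$ minus the projection onto a partner
Bell state, the partners being $0\leftrightarrow3$ and $1\leftrightarrow2$. -/
theorem ptForm_bellDiagonal (p : Fin 4 → ℝ) (w : Idx → ℂ) :
    ptForm (∑ k, (p k : ℂ) • proj (bell k)) w = (p 0 + p 1 + p 2 + p 3) / 2 * vecNormSq w
      - (p 0 * ‖w (0, 1) - w (1, 0)‖ ^ 2 + p 1 * ‖w (0, 1) + w (1, 0)‖ ^ 2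
        + p 2 * ‖w (0, 0) - w (1, 1)‖ ^ 2 + p 3 * ‖w (0, 0) + w (1, 1)‖ ^ 2) / 2 := by
  have h0 : ptForm (proj (bell 0)) w =
      vecNormSq w / 2 - ‖w (0, 1) - w (1, 0)‖ ^ 2 / 2 := by
    refine (ptForm_proj_smul_inv_sqrt_two _ w).trans ?_
    rw [ptForm_proj, trace_mul_map_star_re, vecNormSq_eq]
    simp [coeffMatrix, ket, Matrix.mul_apply, Fin.sum_univ_two, Complex.sq_norm,
      Complex.normSq_apply]
    ring
  have h1 : ptForm (proj (bell 1)) w =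
      vecNormSq w / 2 - ‖w (0, 1) + w (1, 0)‖ ^ 2 / 2 := by
    refine (ptForm_proj_smul_inv_sqrt_two _ w).trans ?_
    rw [ptForm_proj, trace_mul_map_star_re, vecNormSq_eq]
    simp [coeffMatrix, ket, Matrix.mul_apply, Fin.sum_univ_two, Complex.sq_norm,
      Complex.normSq_apply]
    ring
  have h2 : ptForm (proj (bell 2)) w =
      vecNormSq w / 2 - ‖w (0, 0) - w (1, 1)‖ ^ 2 / 2 := by
    refine (ptForm_proj_smul_inv_sqrt_two _ w).trans ?_
    rw [ptForm_proj, trace_mul_map_star_re, vecNormSq_eq]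
    simp [coeffMatrix, ket, Matrix.mul_apply, Fin.sum_univ_two, Complex.sq_norm,
      Complex.normSq_apply]
    ring
  have h3 : ptForm (proj (bell 3)) w =
      vecNormSq w / 2 - ‖w (0, 0) + w (1, 1)‖ ^ 2 / 2 := by
    refine (ptForm_proj_smul_inv_sqrt_two _ w).trans ?_
    rw [ptForm_proj, trace_mul_map_star_re, vecNormSq_eq]
    simp [coeffMatrix, ket, Matrix.mul_apply, Fin.sum_univ_two, Complex.sq_norm,
      Complex.normSq_apply]
    ring
  rw [ptForm_sum, Fin.sum_univ_four, ptForm_smul, ptForm_smul, ptForm_smul, ptForm_smul, h0, h1,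
    h2, h3]
  ring

theorem bellDiagonal_apply (p : Fin 4 → ℝ) (a b : Idx) :
    (∑ k, (p k : ℂ) • proj (bell k)) a b =
      (1 / 2 : ℂ) * (p 0 * ((ket 0 0 + ket 1 1) a * star ((ket 0 0 + ket 1 1) b))
        + p 1 * ((ket 0 0 - ket 1 1) a * star ((ket 0 0 - ket 1 1) b))
        + p 2 * ((ket 0 1 + ket 1 0) a * star ((ket 0 1 + ket 1 0) b))
        + p 3 * ((ket 0 1 - ket 1 0) a * star ((ket 0 1 - ket 1 0) b))) := by
  have h1 : proj (bell 1) = (1 / 2 : ℂ) • proj (ket 0 0 - ket 1 1) := proj_smul_inv_sqrt_two _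
  have h2 : proj (bell 2) = (1 / 2 : ℂ) • proj (ket 0 1 + ket 1 0) := proj_smul_inv_sqrt_two _
  have h3 : proj (bell 3) = (1 / 2 : ℂ) • proj (ket 0 1 - ket 1 0) := proj_smul_inv_sqrt_two _
  rw [Fin.sum_univ_four, proj_bell_zero, h1, h2, h3]
  simp only [Matrix.add_apply, Matrix.smul_apply, proj, vecMulVec_apply, Pi.star_apply, smul_eq_mul]
  ring

/-- The weights of a Bell-diagonal state form a probability distribution. -/
theorem bellDiagonal_weights (ρ : State) {p : Fin 4 → ℝ}
    (hp : ρ.mat = ∑ k, (p k : ℂ) • proj (bell k)) :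
    (∀ k, 0 ≤ p k) ∧ p 0 + p 1 + p 2 + p 3 = 1 := by
  have e : ∀ a b, ρ.mat a b = _ := fun a b => by rw [hp]; exact bellDiagonal_apply p a b
  -- The block with diagonal $(x+y)/2$ and off-diagonal $(x-y)/2$ has eigenvalues `x` and `y`; its
  -- determinant and diagonal give their signs.
  have pair : ∀ (i j : Idx) (x y : ℝ), ρ.mat i i = (((x + y) / 2 : ℝ) : ℂ) →
      ρ.mat j j = (((x + y) / 2 : ℝ) : ℂ) → ρ.mat i j = (((x - y) / 2 : ℝ) : ℂ) →
      0 ≤ x ∧ 0 ≤ y := by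
    intro i j x y h1 h2 h3
    have h4 := sq_norm_le_mul_re ρ.posSemidef i j
    have h5 := re_diag_nonneg ρ.posSemidef i
    rw [h3, h1, h2, Complex.norm_real, Real.norm_eq_abs, sq_abs, Complex.ofReal_re] at h4
    rw [h1, Complex.ofReal_re] at h5
    constructor <;> by_contra! hlt <;> nlinarith
  obtain ⟨p0, p1⟩ := pair (0, 0) (1, 1) (p 0) (p 1)
    (by rw [e]; simp [ket]; ring) (by rw [e]; simp [ket]; ring) (by rw [e]; simp [ket]; ring)
  obtain ⟨p2, p3⟩ := pair (0, 1) (1, 0) (p 2) (p 3)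
    (by rw [e]; simp [ket]; ring) (by rw [e]; simp [ket]; ring) (by rw [e]; simp [ket]; ring)
  refine ⟨fun k => by fin_cases k <;> assumption, ?_⟩
  have h := ρ.trace_eq_one
  simp only [trace, diag_apply, Fintype.sum_prod_type, Fin.sum_univ_two, e] at h
  simp [ket] at h
  have h' : ((p 0 + p 1 + p 2 + p 3 : ℝ) : ℂ) = 1 := by
    push_cast
    linear_combination h
  exact_mod_cast h'

/-- Bell-diagonal states have equal negativity and concurrence. -/
theorem negativity_eq_concurrence_of_isBellDiagonal (ρ : State) (h : ρ.IsBellDiagonal) :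
    negativity ρ = concurrence ρ := by
  obtain ⟨p, hp⟩ := h
  obtain ⟨hnn, hsum⟩ := bellDiagonal_weights ρ hp
  have hform := fun w => (congrArg (ptForm · w) hp).trans (ptForm_bellDiagonal p w)
  simp only [hsum] at hform
  have hN0 := negativity_nonneg ρ
  have hN : 2 * p 0 - 1 ≤ negativity ρ ∧ 2 * p 1 - 1 ≤ negativity ρ ∧
      2 * p 2 - 1 ≤ negativity ρ ∧ 2 * p 3 - 1 ≤ negativity ρ := by
    -- Each test vector is the unnormalized partner of one Bell state, an eigenvector of
    -- $\rho^\Gamma$ for $\tfrac12-p_k$.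
    have t0 := neg_ptForm_le_negativity ρ (ofCoeff !![0, 1; -1, 0])
    have t1 := neg_ptForm_le_negativity ρ (ofCoeff !![0, 1; 1, 0])
    have t2 := neg_ptForm_le_negativity ρ (ofCoeff !![1, 0; 0, -1])
    have t3 := neg_ptForm_le_negativity ρ (ofCoeff !![1, 0; 0, 1])
    rw [hform, vecNormSq_eq] at t0 t1 t2 t3
    norm_num [ofCoeff] at t0 t1 t2 t3
    refine ⟨?_, ?_, ?_, ?_⟩ <;> linarith
  obtain ⟨n0, n1, n2, n3⟩ := hN
  refine le_antisymm (negativity_le_concurrence ρ) (concurrence_le_of_forall ρ hN0 fun w => ?_)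
  have hn : vecNormSq w = (‖w (0, 1) - w (1, 0)‖ ^ 2 + ‖w (0, 1) + w (1, 0)‖ ^ 2
      + ‖w (0, 0) - w (1, 1)‖ ^ 2 + ‖w (0, 0) + w (1, 1)‖ ^ 2) / 2 := by
    rw [vecNormSq_eq]
    simp [Complex.sq_norm, Complex.normSq_apply]
    ring
  have hdet : 4 * vecDet w = (w (0, 0) + w (1, 1)) ^ 2 - (w (0, 0) - w (1, 1)) ^ 2
      - (w (0, 1) + w (1, 0)) ^ 2 + (w (0, 1) - w (1, 0)) ^ 2 := by
    rw [vecDet]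
    ring
  rw [hform, hn]
  have hd4 : 4 * ‖vecDet w‖ = ‖4 * vecDet w‖ := by rw [norm_mul, Complex.norm_ofNat]
  rw [hdet] at hd4
  set b0 := w (0, 0) + w (1, 1)
  set b1 := w (0, 0) - w (1, 1)
  set b2 := w (0, 1) + w (1, 0)
  set b3 := w (0, 1) - w (1, 0)
  set D := ‖vecDet w‖
  have hD0 : 0 ≤ D := norm_nonneg _
  -- In Bell coordinates the determinant is a signed sum of four squares. Factors of `Complex.I`
  -- adjust the signs, and the reverse triangle inequality isolates any one coordinate.
  have tri : ∀ x y z t : ℂ, ‖x‖ ^ 2 - ‖y‖ ^ 2 - ‖z‖ ^ 2 - ‖t‖ ^ 2 ≤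
      ‖x ^ 2 + y ^ 2 + z ^ 2 + t ^ 2‖ := fun x y z t => by
    have h1 := norm_sub_norm_le (x ^ 2) (-(y ^ 2 + z ^ 2 + t ^ 2))
    have h2 := norm_add₃_le (a := y ^ 2) (b := z ^ 2) (c := t ^ 2)
    rw [norm_neg, sub_neg_eq_add, ← add_assoc, ← add_assoc] at h1
    simp only [norm_pow] at h1 h2
    linarith
  have hI : ∀ z : ℂ, (Complex.I * z) ^ 2 = -z ^ 2 := fun z => by
    rw [mul_pow, Complex.I_sq, neg_one_mul]
  have hIn : ∀ z : ℂ, ‖Complex.I * z‖ = ‖z‖ := fun z => by rw [norm_mul, Complex.norm_I, one_mul]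
  have d0 : ‖b3‖ ^ 2 - ‖b2‖ ^ 2 - ‖b1‖ ^ 2 - ‖b0‖ ^ 2 ≤ 4 * D := by
    have := tri b3 (Complex.I * b2) (Complex.I * b1) b0
    simp only [hI, hIn] at this
    rwa [hd4, show b0 ^ 2 - b1 ^ 2 - b2 ^ 2 + b3 ^ 2 = b3 ^ 2 + -b2 ^ 2 + -b1 ^ 2 + b0 ^ 2 by ring]
  have d1 : ‖b2‖ ^ 2 - ‖b3‖ ^ 2 - ‖b1‖ ^ 2 - ‖b0‖ ^ 2 ≤ 4 * D := by
    have := tri (Complex.I * b2) b3 (Complex.I * b1) b0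
    simp only [hI, hIn] at this
    rwa [hd4, show b0 ^ 2 - b1 ^ 2 - b2 ^ 2 + b3 ^ 2 = -b2 ^ 2 + b3 ^ 2 + -b1 ^ 2 + b0 ^ 2 by ring]
  have d2 : ‖b1‖ ^ 2 - ‖b3‖ ^ 2 - ‖b2‖ ^ 2 - ‖b0‖ ^ 2 ≤ 4 * D := by
    have := tri (Complex.I * b1) b3 (Complex.I * b2) b0
    simp only [hI, hIn] at this
    rwa [hd4, show b0 ^ 2 - b1 ^ 2 - b2 ^ 2 + b3 ^ 2 = -b1 ^ 2 + b3 ^ 2 + -b2 ^ 2 + b0 ^ 2 by ring]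
  have d3 : ‖b0‖ ^ 2 - ‖b3‖ ^ 2 - ‖b2‖ ^ 2 - ‖b1‖ ^ 2 ≤ 4 * D := by
    have := tri b0 b3 (Complex.I * b2) (Complex.I * b1)
    simp only [hI, hIn] at this
    rwa [hd4, show b0 ^ 2 - b1 ^ 2 - b2 ^ 2 + b3 ^ 2 = b0 ^ 2 + b3 ^ 2 + -b2 ^ 2 + -b1 ^ 2 by ring]
  -- For a weight $P>1/2$, the others satisfy $\tfrac12-q\ge P-\tfrac12$, so minus the form is at
  -- most $\tfrac12(P-\tfrac12)(x-y-z-t)\le(2P-1)D$.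
  have key : ∀ {P q r s x y z t : ℝ}, P + q + r + s = 1 → 0 ≤ q → 0 ≤ r → 0 ≤ s → 0 ≤ y → 0 ≤ z →
      0 ≤ t → 1 / 2 < P → x - y - z - t ≤ 4 * D → 2 * P - 1 ≤ negativity ρ →
      -(1 / 2 * ((x + y + z + t) / 2) - (P * x + q * y + r * z + s * t) / 2) ≤
        negativity ρ * D := by
    intro P q r s x y z t h1 hq hr hs hy hz ht hP hD hneg
    have e1 := mul_le_mul_of_nonneg_left hD (show 0 ≤ P - 1 / 2 by linarith)
    have e2 := mul_le_mul_of_nonneg_right hneg hD0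
    have e3 : 0 ≤ (1 - P - q) * y := mul_nonneg (by linarith) hy
    have e4 : 0 ≤ (1 - P - r) * z := mul_nonneg (by linarith) hz
    have e5 : 0 ≤ (1 - P - s) * t := mul_nonneg (by linarith) ht
    linarith
  have q0 := sq_nonneg ‖b0‖
  have q1 := sq_nonneg ‖b1‖
  have q2 := sq_nonneg ‖b2‖
  have q3 := sq_nonneg ‖b3‖
  rcases lt_or_ge (1 / 2) (p 0) with g0 | g0
  · exact (key hsum (hnn 1) (hnn 2) (hnn 3) q2 q1 q0 g0 d0 n0)
  rcases lt_or_ge (1 / 2) (p 1) with g1 | g1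
  · have := key (show p 1 + p 0 + p 2 + p 3 = 1 by linarith) (hnn 0)
      (hnn 2) (hnn 3) q3 q1 q0 g1 d1 n1
    linarith
  rcases lt_or_ge (1 / 2) (p 2) with g2 | g2
  · have := key (show p 2 + p 0 + p 1 + p 3 = 1 by linarith) (hnn 0)
      (hnn 1) (hnn 3) q3 q2 q0 g2 d2 n2
    linarith
  rcases lt_or_ge (1 / 2) (p 3) with g3 | g3
  · have := key (show p 3 + p 0 + p 1 + p 2 = 1 by linarith) (hnn 0)
      (hnn 1) (hnn 2) q3 q2 q1 g3 d3 n3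
    linarith
  -- With all weights at most $1/2$ the form itself is nonnegative.
  have m0 := mul_nonneg (sub_nonneg.2 g0) q3
  have m1 := mul_nonneg (sub_nonneg.2 g1) q2
  have m2 := mul_nonneg (sub_nonneg.2 g2) q1
  have m3 := mul_nonneg (sub_nonneg.2 g3) q0
  have m4 := mul_nonneg hN0 hD0
  linarith

end TwoQubit

theorem theorem2 (ρ : TwoQubit.State) :
    -- upper bound
    TwoQubit.negativity ρ ≤ TwoQubit.concurrence ρ ∧
    -- for entangled states: the negative eigenvalue `μ` of the partial transpose, its eigenvector
    -- `v` (unique up to a scalar), and the equality case of the upper bound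
    (0 < TwoQubit.concurrence ρ →
      ∃ (μ : ℝ) (v : TwoQubit.Idx → ℂ), μ < 0 ∧ star v ⬝ᵥ v = 1 ∧
        TwoQubit.partialTranspose ρ.mat *ᵥ v = (μ : ℂ) • v ∧
        (∀ (ν : ℝ) (w : TwoQubit.Idx → ℂ), ν < 0 → w ≠ 0 →
          TwoQubit.partialTranspose ρ.mat *ᵥ w = (ν : ℂ) • w → ν = μ ∧ ∃ c : ℂ, w = c • v) ∧
        TwoQubit.negativity ρ = 2 * |μ| ∧
        (TwoQubit.negativity ρ = TwoQubit.concurrence ρ ↔ TwoQubit.IsBellUpToLocalUnitary v)) ∧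
    -- pure states and Bell-diagonal states attain the upper bound
    (ρ.IsPure → TwoQubit.negativity ρ = TwoQubit.concurrence ρ) ∧
    (ρ.IsBellDiagonal → TwoQubit.negativity ρ = TwoQubit.concurrence ρ) ∧
    -- lower bound, in both forms
    √((1 - TwoQubit.concurrence ρ) ^ 2 + TwoQubit.concurrence ρ ^ 2) -
        (1 - TwoQubit.concurrence ρ) ≤ TwoQubit.negativity ρ ∧
    0 ≤ TwoQubit.negativity ρ ^ 2 +
        2 * TwoQubit.negativity ρ * (1 - TwoQubit.concurrence ρ) - TwoQubit.concurrence ρ ^ 2 ∧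
    -- equality case of the lower bound, for entangled states
    (0 < TwoQubit.concurrence ρ →
      (TwoQubit.negativity ρ =
          √((1 - TwoQubit.concurrence ρ) ^ 2 + TwoQubit.concurrence ρ ^ 2) -
            (1 - TwoQubit.concurrence ρ) ↔
        TwoQubit.LocalUnitaryEquiv ρ.mat
          (TwoQubit.quasiDistillable (TwoQubit.concurrence ρ))) ∧
      (TwoQubit.concurrence ρ < 1 →
        (TwoQubit.quasiDistillable (TwoQubit.concurrence ρ)).rank = 2)) ∧
    -- the weight of the Bell state in a quasi-distillable state is its concurrence
    (∀ c : ℝ, 0 ≤ c → c ≤ 1 →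
      TwoQubit.LocalUnitaryEquiv ρ.mat (TwoQubit.quasiDistillable c) →
        TwoQubit.concurrence ρ = c) := by
  refine ⟨TwoQubit.negativity_le_concurrence ρ, fun hC => ?_,
    TwoQubit.negativity_eq_concurrence_of_isPure ρ,
    TwoQubit.negativity_eq_concurrence_of_isBellDiagonal ρ, TwoQubit.sqrt_sub_le_negativity ρ, ?_,
    fun hC => ⟨⟨fun h => ?_, TwoQubit.negativity_of_quasiDistillable ρ hC⟩,
      TwoQubit.rank_quasiDistillable hC⟩,
    fun c h0 h1 => TwoQubit.concurrence_of_quasiDistillable ρ h0 h1⟩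
  · obtain ⟨μ, v, hμ, hv1, hv, hN⟩ :=
      TwoQubit.exists_negative_eigenvalue ρ (TwoQubit.negativity_pos ρ hC)
    exact ⟨μ, v, hμ, hv1, hv,
      fun ν w hν hw0 hw => TwoQubit.eigenvector_unique ρ hμ hν hv1 hw0 hv hw, hN,
      TwoQubit.negativity_eq_concurrence_iff ρ hC hμ hv1 hv hN⟩
  · linarith [(TwoQubit.negativity_lower_bound ρ).2]
  · exact TwoQubit.localUnitaryEquiv_of_eq ρ hC (TwoQubit.lower_bound_sq h)
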